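/- **Setting.** Let $\mathbb S^2\subset\mathbb R^3$ be the unit sphere with its rotation-invariant area measure $d\mu=\sin\theta\,d\theta\,d\varphi$ and geodesic distance $d$; $\|\cdot\|_2$ is the norm of the space $L^2(\mathbb S^2)$ of complex-valued square-integrable functions. For a point $\omega=(\theta,\varphi)$ (colatitude, longitude) let $R_\omega$ be the rotation with $zyz$ Euler angles $(\varphi,\theta,0)$, acting by $(R_\omega g)(\omega')=g(R_\omega^{-1}\omega')$, and put $$(f\star g)(\omega)=\int_{\mathbb S^2} f(\omega')\,\overline{(R_\omega g)(\omega')}\,d\mu(\omega').$$ Fix a dilation parameter $\alpha>1$, a bandlimit $L\in\mathbb N$ and a minimum scale $J_0\in\mathbb N_0$ with $0\le J_0<J:=\lceil\log_\alpha L\rceil$. Let $s(t)=e^{-1/(1-t^2)}$ for $|t|<1$ and $s(t)=0$ otherwise, $s_\alpha(t)=s\bigl(\tfrac{2\alpha}{\alpha-1}(t-\alpha^{-1})-1\bigr)$, $$k_\alpha(t)=\frac{\int_t^1 s_\alpha(u)^2\,\frac{du}{u}}{\int_{\alpha^{-1}}^1 s_\alpha(u)^2\,\frac{du}{u}},\qquad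 \kappa_\alpha(t)=\sqrt{k_\alpha(\alpha^{-1}t)-k_\alpha(t)}.$$ The axisymmetric wavelets $\psi_j$ ($J_0\le j\le J$) and the scaling function $\Phi$ are the functions on $\mathbb S^2$ whose spherical harmonic coefficients are $$(\hat\psi_j)_{\ell m}=\sqrt{\tfrac{2\ell+1}{4\pi}}\;\kappa_\alpha(\alpha^{-j}\ell)\,\delta_{m0},\qquad \hat\Phi_{\ell m}=\sqrt{\tfrac{2\ell+1}{4\pi}}\;\sqrt{k_\alpha(\alpha^{-J_0}\ell)}\,\delta_{m0}.$$ For a path $p=(j_1,\dots,j_d)$ set $U[p]f=\bigl|\,\cdots\bigl||f\star\psi_{j_1}|\star\psi_{j_2}\bigr|\cdots\star\psi_{j_d}\bigr|$ (with $U[p]f=f$ for the empty path, $d=0$) and $S[p]f=(U[p]f)\star\Phi$. For $D\in\mathbb N_0$ let $\mathbb P_D$ be the set of all paths with $J_0\le j_i\le J$ and $0\le d\le D$, let $\mathcal S_{\mathbb P_D}f=(S[p]f)_{p\in\mathbb P_D}$, and for a family $F=(F_p)_{p\in\mathbb P_D}$ let $\|F\|_2=\bigl(\sum_{p\in\mathbb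 P_D}\|F_p\|_2^2\bigr)^{1/2}$. For an isometry $\zeta$ of $\mathbb S^2$ let $(V_\zeta f)(\omega)=f(\zeta^{-1}\omega)$ and $\|\zeta\|_\infty=\sup_{\omega\in\mathbb S^2}d(\omega,\zeta(\omega))$. **Theorem 1 (Isometric invariance).** There is an absolute constant $C>0$ such that for all $\alpha$, $L$, $J_0$ as above, all $D\in\mathbb N_0$, every isometry $\zeta\in\mathrm{Isom}(\mathbb S^2)$ and every $f\in L^2(\mathbb S^2)$, $$\|\mathcal S_{\mathbb P_D}f-\mathcal S_{\mathbb P_D}V_\zeta f\|_2\le C\,L^{5/2}(D+1)^{1/2}\alpha^{J_0}\,\|\zeta\|_\infty\,\|f\|_2 .$$ -/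

import Mathlib

open MeasureTheory
open scoped ENNReal

noncomputable section

namespace SphericalScattering

/-! ### The sphere, its area measure, geodesic distance and isometries -/

/-- The unit sphere `𝕊²` in Euclidean 3-space. -/
abbrev S2 : Type := Metric.sphere (0 : EuclideanSpace ℝ (Fin 3)) 1

/-- The rotation invariant area measure `sin θ dθ dφ` on `𝕊²` (total mass `4π`). -/
abbrev area : Measure S2 := (volume : Measure (EuclideanSpace ℝ (Fin 3))).toSphere

/-- The geodesic (great circle) distance on `𝕊²`: the angle between two unit vectors. -/
def geoDist (x y : S2) : ℝ :=
  InnerProductGeometry.angle (x : EuclideanSpace ℝ (Fin 3)) (y : EuclideanSpace ℝ (Fin 3))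

/-- `‖ζ‖_∞`, the supremum of the geodesic displacements `d(ω, ζ ω)`. Isometries of `𝕊²` for the
chordal distance (the metric of `S2`) and for the geodesic distance are the same maps, because each
distance is a strictly increasing function of the other. -/
def displacement (ζ : S2 ≃ᵢ S2) : ℝ := ⨆ ω : S2, geoDist ω (ζ ω)

/-- The action of an isometry on signals, `(V_ζ f)(ω) = f (ζ⁻¹ ω)`. -/
def act (ζ : S2 ≃ᵢ S2) (f : S2 → ℂ) : S2 → ℂ := fun ω => f (ζ.symm ω)

/-! ### Rotations -/

/-- Rotation by the angle `t` about the third coordinate axis. -/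
def rotZ (t : ℝ) : Matrix.specialOrthogonalGroup (Fin 3) ℝ :=
  ⟨!![Real.cos t, -Real.sin t, 0; Real.sin t, Real.cos t, 0; 0, 0, 1], by
    have h := Real.sin_sq_add_cos_sq t
    rw [Matrix.mem_specialOrthogonalGroup_iff, Matrix.mem_orthogonalGroup_iff]
    refine ⟨?_, ?_⟩
    · ext i j
      fin_cases i <;> fin_cases j <;>
        simp [Matrix.mul_apply, Fin.sum_univ_three] <;> nlinarith
    · simp [Matrix.det_fin_three]; nlinarith⟩

/-- Rotation by the angle `t` about the second coordinate axis. -/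
def rotY (t : ℝ) : Matrix.specialOrthogonalGroup (Fin 3) ℝ :=
  ⟨!![Real.cos t, 0, Real.sin t; 0, 1, 0; -Real.sin t, 0, Real.cos t], by
    have h := Real.sin_sq_add_cos_sq t
    rw [Matrix.mem_specialOrthogonalGroup_iff, Matrix.mem_orthogonalGroup_iff]
    refine ⟨?_, ?_⟩
    · ext i j
      fin_cases i <;> fin_cases j <;>
        simp [Matrix.mul_apply, Fin.sum_univ_three] <;> nlinarith
    · simp [Matrix.det_fin_three]; nlinarith⟩

/-- The rotation with `zyz` Euler angles `(a, b, c)`. -/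
def euler (a b c : ℝ) : Matrix.specialOrthogonalGroup (Fin 3) ℝ := rotZ a * rotY b * rotZ c

/-- The action of a rotation on points of the sphere. -/
def rotatePoint (R : Matrix.specialOrthogonalGroup (Fin 3) ℝ) (x : S2) : S2 :=
  ⟨WithLp.toLp 2 ((R : Matrix (Fin 3) (Fin 3) ℝ).mulVec (x : EuclideanSpace ℝ (Fin 3)).ofLp), by
    have hR := (Matrix.mem_orthogonalGroup_iff' (Fin 3) ℝ).1
      (Matrix.mem_specialOrthogonalGroup_iff.1 R.2).1
    have h : ‖WithLp.toLp 2 ((R : Matrix (Fin 3) (Fin 3) ℝ).mulVec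
        (x : EuclideanSpace ℝ (Fin 3)).ofLp)‖ ^ 2 = ‖(x : EuclideanSpace ℝ (Fin 3))‖ ^ 2 := by
      rw [← real_inner_self_eq_norm_sq, ← real_inner_self_eq_norm_sq]
      simp only [EuclideanSpace.inner_eq_star_dotProduct, star_trivial]
      rw [Matrix.dotProduct_mulVec, ← Matrix.mulVec_transpose, Matrix.mulVec_mulVec, hR,
        Matrix.one_mulVec]
    rw [mem_sphere_zero_iff_norm, (sq_eq_sq₀ (norm_nonneg _) (norm_nonneg _)).1 h]
    simp⟩

/-- The colatitude `θ ∈ [0, π]` of a point of the sphere. -/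
def colatitude (ω : S2) : ℝ := Real.arccos ((ω : EuclideanSpace ℝ (Fin 3)) 2)

/-- The longitude `φ` of a point of the sphere (modulo `2π`; zero at the poles). -/
def longitude (ω : S2) : ℝ :=
  Complex.arg ⟨(ω : EuclideanSpace ℝ (Fin 3)) 0, (ω : EuclideanSpace ℝ (Fin 3)) 1⟩

/-- `R_ω = R_(φ, θ, 0)` for the point `ω = (θ, φ)`. -/
def pointRotation (ω : S2) : Matrix.specialOrthogonalGroup (Fin 3) ℝ :=
  euler (longitude ω) (colatitude ω) 0

/-- Rotation of a signal, `(R g)(ω) = g (R⁻¹ ω)`. -/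
def rotateSignal (R : Matrix.specialOrthogonalGroup (Fin 3) ℝ) (g : S2 → ℂ) : S2 → ℂ :=
  fun ω => g (rotatePoint R⁻¹ ω)

/-- Spherical convolution with an axisymmetric signal,
`(f ⋆ g)(ω) = ⟨f, R_ω g⟩ = ∫ f(ω') conj ((R_ω g)(ω')) dμ(ω')`. -/
def conv (f g : S2 → ℂ) : S2 → ℂ :=
  fun ω => ∫ ω', f ω' * (starRingEnd ℂ) (rotateSignal (pointRotation ω) g ω') ∂area

/-! ### Scale-discretized wavelets -/

/-- The Legendre polynomial `P_ℓ(X) = (2^ℓ ℓ!)⁻¹ (d/dX)^ℓ (X² - 1)^ℓ`. -/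
def legendre (l : ℕ) : Polynomial ℝ :=
  Polynomial.C ((2 ^ l * (Nat.factorial l : ℝ))⁻¹) *
    Polynomial.derivative^[l] ((Polynomial.X ^ 2 - 1) ^ l)

/-- The spherical harmonic `Y_{ℓ0}(θ, φ) = √((2ℓ+1)/4π) P_ℓ(cos θ)` of order zero; here `cos θ` is
the third coordinate. -/
def zonalHarmonic (l : ℕ) (ω : S2) : ℝ :=
  Real.sqrt ((2 * l + 1) / (4 * Real.pi)) *
    (legendre l).eval ((ω : EuclideanSpace ℝ (Fin 3)) 2)

/-- The bump function `s(t) = exp (-1/(1-t²))` on `(-1, 1)`, zero elsewhere. -/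
def bump (t : ℝ) : ℝ :=
  if t ∈ Set.Ioo (-1 : ℝ) 1 then Real.exp (-(1 - t ^ 2)⁻¹) else 0

/-- `s_α`, the bump function rescaled to the interval `[α⁻¹, 1]`. -/
def bumpScaled (α t : ℝ) : ℝ := bump (2 * α / (α - 1) * (t - α⁻¹) - 1)

/-- `k_α`, decreasing smoothly from `1` on `t ≤ α⁻¹` to `0` on `t ≥ 1`. -/
def smoothStep (α t : ℝ) : ℝ :=
  (∫ u in t..1, bumpScaled α u ^ 2 / u) / (∫ u in α⁻¹..1, bumpScaled α u ^ 2 / u)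

/-- The wavelet generating function `κ_α(t) = √(k_α(t/α) - k_α(t))`. -/
def generator (α t : ℝ) : ℝ := Real.sqrt (smoothStep α (α⁻¹ * t) - smoothStep α t)

/-- The order zero harmonic coefficients of the wavelet `ψ_j`; those of order `m ≠ 0` vanish. -/
def waveletCoeff (α : ℝ) (j l : ℕ) : ℝ :=
  Real.sqrt ((2 * l + 1) / (4 * Real.pi)) * generator α ((α ^ j)⁻¹ * l)

/-- The order zero harmonic coefficients of the scaling function `Φ`; those of order `m ≠ 0`
vanish. -/
def scalingCoeff (α : ℝ) (J₀ l : ℕ) : ℝ :=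
  Real.sqrt ((2 * l + 1) / (4 * Real.pi)) * Real.sqrt (smoothStep α ((α ^ J₀)⁻¹ * l))

/-- The axisymmetric wavelet `ψ_j`. The coefficients vanish for `ℓ ≥ α ^ (j + 1)`, so that the
series is a finite sum. -/
def wavelet (α : ℝ) (j : ℕ) (ω : S2) : ℂ :=
  ((∑' l : ℕ, waveletCoeff α j l * zonalHarmonic l ω : ℝ) : ℂ)

/-- The axisymmetric scaling function `Φ`. The coefficients vanish for `ℓ ≥ α ^ J₀`, so that the
series is a finite sum. -/
def scalingFunction (α : ℝ) (J₀ : ℕ) (ω : S2) : ℂ :=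
  ((∑' l : ℕ, scalingCoeff α J₀ l * zonalHarmonic l ω : ℝ) : ℂ)

/-! ### Scattering networks -/

/-- The maximum wavelet scale `J = ⌈log_α L⌉` for the bandlimit `L`. -/
def maxScale (α : ℝ) (L : ℕ) : ℕ := ⌈Real.logb α L⌉₊

/-- The one-scale scattering propagator `U[j] f = |f ⋆ ψ_j|`. -/
def propagator (α : ℝ) (j : ℕ) (f : S2 → ℂ) : S2 → ℂ :=
  fun ω => ((‖conv f (wavelet α j) ω‖ : ℝ) : ℂ)

/-- The scattering propagator `U[p] f = U[j_d] ⋯ U[j_2] U[j_1] f` of the path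
`p = (j_1, …, j_d)`; for the empty path it is `f`. -/
def pathPropagator (α : ℝ) (p : List ℕ) (f : S2 → ℂ) : S2 → ℂ :=
  p.foldl (fun g j => propagator α j g) f

/-- The scattering transform `S[p] f = (U[p] f) ⋆ Φ`. -/
def scattering (α : ℝ) (J₀ : ℕ) (p : List ℕ) (f : S2 → ℂ) : S2 → ℂ :=
  conv (pathPropagator α p f) (scalingFunction α J₀)

/-- The set `P_D` of all paths of depth at most `D` with scales between `J₀` and `J`. -/
def pathSet (J₀ J D : ℕ) : Set (List ℕ) :=
  {p | p.length ≤ D ∧ ∀ j ∈ p, J₀ ≤ j ∧ j ≤ J}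

/-- The scattering network `S_P f`, the collection of the `S[p] f` for `p ∈ P`. -/
def network (α : ℝ) (J₀ : ℕ) (P : Set (List ℕ)) (f : S2 → ℂ) : P → S2 → ℂ :=
  fun p => scattering α J₀ p f

/-- The norm `‖F‖₂ = (∑_p ‖F_p‖₂²)^(1/2)` of a collection of signals. -/
def collectionNorm {P : Set (List ℕ)} (F : P → S2 → ℂ) : ℝ≥0∞ :=
  (∑' p : P, eLpNorm (F p) 2 area ^ 2) ^ (1 / 2 : ℝ)

end SphericalScattering

end

noncomputable section

namespace SphericalScattering

/-! ### Legendre polynomials -/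

section LegendrePolynomials

open Polynomial

/-! All filters are zonal, so each convolution is an operator with kernel `p (cos d(x, z))` for a
polynomial `p` (`conv_eq_zonalOp`). Such operators, and the pointwise modulus, commute with every
isometry. Hence `U[p] V_ζ f = V_ζ U[p] f`, and only the final low-pass step has to be estimated.

For that step, `(g ⋆ Φ)(x) - (V_ζ g ⋆ Φ)(x)` is the difference of the values of `g ⋆ Φ` at `x` and
at `ζ⁻¹ x`. Cauchy–Schwarz bounds it by `‖g‖₂` times the `L²` distance of two translated kernels. By
the reproducing property of Legendre kernels (`integral_legendre_mul_legendre`) the square of that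
distance is a weighted sum of `1 - P_l (cos d(x, ζ⁻¹ x))`. Since `|P_l'| ≤ l²` on `[-1, 1]`, each
such term is at most `l² ‖ζ‖_∞² / 2`, and only degrees `l < α ^ J₀ < L` contribute. This gives a
bound of order `α ^ J₀ L ‖ζ‖_∞ ‖g‖₂`.

To sum over paths, the squares of the wavelet generators telescope to at most `1`, so one layer does
not increase energy (`sum_eLpNorm_propagator_sq_le`). The paths of depth at most `D` then carry
energy at most `(D + 1) ‖f‖₂²`. The resulting power of `L` is `1`, below the `5/2` allowed.

Spherical harmonics of nonzero order never appear: the Legendre facts come from Rodrigues' formula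
and from rotation invariance of the area measure. -/

lemma legendre_zero : legendre 0 = 1 := by simp [legendre]

lemma legendre_one : legendre 1 = X := by
  rw [legendre]
  simp only [pow_one, Nat.factorial_one, Nat.cast_one, mul_one, Function.iterate_one]
  simp only [derivative_sub, derivative_X_pow, derivative_one]
  simp only [Nat.cast_ofNat, sub_zero, ← mul_assoc]
  rw [← C_mul]
  simp

lemma natDegree_legendre_le (l : ℕ) : (legendre l).natDegree ≤ l := by
  refine (natDegree_C_mul_le _ _).trans ?_
  refine (natDegree_iterate_derivative _ _).trans ?_
  have h : ((X ^ 2 - 1 : ℝ[X]) ^ l).natDegree ≤ l * 2 := by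
    refine natDegree_pow_le_of_le l ?_
    compute_degree
  omega

/-- The ladder relation `P'_{l+2} = (2l+3) P_{l+1} + P'_l`. -/
lemma derivative_legendre_add_two (l : ℕ) :
    derivative (legendre (l + 2)) =
      C (2 * (l : ℝ) + 3) * legendre (l + 1) + derivative (legendre l) := by
  -- Writing `X² = (X² - 1) + 1` in the second derivative leaves only powers of `X² - 1`; the
  -- remaining `l + 1` derivatives turn them into multiples of `P_{l+1}` and `P_l'`.
  have key : derivative (derivative ((X ^ 2 - 1 : ℝ[X]) ^ (l + 2))) =
      C (2 * ((l : ℝ) + 2) * (2 * l + 3)) * (X ^ 2 - 1) ^ (l + 1) +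
        C (4 * ((l : ℝ) + 2) * (l + 1)) * (X ^ 2 - 1) ^ l := by
    simp only [derivative_pow, derivative_mul, derivative_sub, derivative_X, derivative_one,
      derivative_natCast, derivative_ofNat, derivative_zero, map_natCast, Nat.cast_add,
      Nat.cast_ofNat, Nat.cast_one, Nat.add_one_sub_one, show l + 2 - 1 = l + 1 from rfl, map_add,
      map_mul, map_ofNat, map_one]
    ring
  have e1 : derivative (legendre (l + 2)) =
      C ((2 ^ (l + 2) * ((l + 2).factorial : ℝ))⁻¹) *
        derivative^[l + 1] (derivative (derivative ((X ^ 2 - 1 : ℝ[X]) ^ (l + 2)))) := by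
    rw [legendre, derivative_C_mul, ← Function.iterate_succ_apply' derivative,
      ← Function.iterate_succ_apply derivative, ← Function.iterate_succ_apply derivative]
  rw [e1, key, iterate_map_add, iterate_derivative_C_mul, iterate_derivative_C_mul, legendre,
    legendre, derivative_C_mul, ← Function.iterate_succ_apply' derivative, mul_add, ← mul_assoc,
    ← mul_assoc, ← mul_assoc, ← C_mul, ← C_mul, ← C_mul]
  have c1 : (2 ^ (l + 2) * ((l + 2).factorial : ℝ))⁻¹ * (2 * ((l : ℝ) + 2) * (2 * l + 3)) =
      (2 * (l : ℝ) + 3) * (2 ^ (l + 1) * ((l + 1).factorial : ℝ))⁻¹ := by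
    rw [Nat.factorial_succ (l + 1)]
    have := Nat.cast_ne_zero (R := ℝ).2 (Nat.factorial_ne_zero (l + 1))
    push_cast
    field_simp
    ring
  have c2 : (2 ^ (l + 2) * ((l + 2).factorial : ℝ))⁻¹ * (4 * ((l : ℝ) + 2) * (l + 1)) =
      (2 ^ l * (l.factorial : ℝ))⁻¹ := by
    rw [Nat.factorial_succ (l + 1), Nat.factorial_succ l]
    have := Nat.cast_ne_zero (R := ℝ).2 (Nat.factorial_ne_zero l)
    push_cast
    field_simp
    ring
  rw [c1, c2]

/-- `r` is an `l`-fold root of `(X - r)^l (X + r)^l`, so the `l`-th derivative at `r` is `l!` times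
the cofactor value `(2r)^l`. -/
lemma legendre_eval_of_sq_eq_one (l : ℕ) {r : ℝ} (hr : r ^ 2 = 1) :
    (legendre l).eval r = r ^ l := by
  have hmap : ((X ^ 2 - 1 : ℝ[X]) ^ l).map (algebraMap ℝ ℝ) = (X - C r) ^ l * (X + C r) ^ l := by
    rw [← mul_pow]
    have : (X - C r) * (X + C r) = X ^ 2 - 1 := by
      have hexp : X ^ 2 - C r ^ 2 = (X - C r) * (X + C r) := by ring
      rw [← hexp, ← C_pow, hr, C_1]
    rw [this]
    simp
  have h := aeval_iterate_derivative_self ((X ^ 2 - 1 : ℝ[X]) ^ l) l r hmap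
  simp only [coe_aeval_eq_eval] at h
  rw [legendre, eval_C_mul, h]
  have := Nat.cast_ne_zero (R := ℝ).2 (Nat.factorial_ne_zero l)
  simp only [eval_pow, eval_add, eval_X, eval_C, nsmul_eq_mul, ← two_mul, mul_pow]
  field_simp

lemma legendre_eval_one (l : ℕ) : (legendre l).eval 1 = 1 := by
  rw [legendre_eval_of_sq_eq_one l (one_pow 2), one_pow]

lemma intervalIntegrable_eval (p : ℝ[X]) (a b : ℝ) :
    IntervalIntegrable (fun t => p.eval t) volume a b :=
  p.continuous.intervalIntegrable a b

lemma integral_eval_derivative_mul (p q : ℝ[X]) (a b : ℝ) :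
    ∫ t in a..b, (derivative p * q).eval t =
      (p * q).eval b - (p * q).eval a - ∫ t in a..b, (p * derivative q).eval t := by
  have h := intervalIntegral.integral_mul_deriv_eq_deriv_mul (a := a) (b := b)
    (u := fun t => q.eval t) (v := fun t => p.eval t)
    (fun t _ => q.hasDerivAt t) (fun t _ => p.hasDerivAt t)
    (intervalIntegrable_eval _ _ _) (intervalIntegrable_eval _ _ _)
  simp only [eval_mul]
  simp only [mul_comm (eval _ (derivative p)), mul_comm (eval _ p)]
  rw [h]

/-- Repeated integration by parts: a derivative of order below `l` is still divisible by `X² - 1`,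
so the boundary terms vanish. -/
lemma integral_iterate_derivative_mul_eq_zero (l : ℕ) :
    ∀ m ≤ l, ∀ q : ℝ[X], derivative^[m] q = 0 →
      ∫ t in (-1 : ℝ)..1, (derivative^[m] ((X ^ 2 - 1) ^ l) * q).eval t = 0 := by
  intro m
  induction m with
  | zero => intro _ q hq; simp_all
  | succ m ih =>
    intro hm q hq
    have hdvd : (X ^ 2 - 1 : ℝ[X]) ∣ derivative^[m] ((X ^ 2 - 1) ^ l) :=
      (dvd_pow_self _ (by omega)).trans (pow_sub_dvd_iterate_derivative_pow _ l m)
    have hz : ∀ r : ℝ, r ^ 2 = 1 → (derivative^[m] ((X ^ 2 - 1) ^ l) : ℝ[X]).eval r = 0 := by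
      intro r hr
      obtain ⟨c, hc⟩ := hdvd
      rw [hc]
      simp [hr]
    rw [Function.iterate_succ_apply', integral_eval_derivative_mul, eval_mul, eval_mul,
      hz 1 (by norm_num), hz (-1) (by norm_num), ih (by omega) _ (by
        rwa [← Function.iterate_succ_apply derivative])]
    simp

lemma integral_legendre_mul_eq_zero {l : ℕ} {q : ℝ[X]} (hq : q.degree < l) :
    ∫ t in (-1 : ℝ)..1, (legendre l * q).eval t = 0 := by
  have h := integral_iterate_derivative_mul_eq_zero l l le_rfl q
    (iterate_derivative_eq_zero_of_degree_lt hq)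
  simp only [legendre, mul_assoc, eval_C_mul, intervalIntegral.integral_const_mul, h, mul_zero]

lemma degree_derivative_legendre_lt (l : ℕ) : (derivative (legendre l)).degree < l := by
  rcases eq_or_ne (legendre l) 0 with h | h
  · rw [h, derivative_zero, degree_zero]
    exact WithBot.bot_lt_coe l
  · exact (degree_derivative_lt h).trans_le (natDegree_le_iff_degree_le.1 (natDegree_legendre_le l))

/-- Compute `∫ P'_{l+1} P_l` twice. By parts only the boundary term `2` survives, since `P_l'` is
orthogonal to `P_{l+1}`; by the ladder relation it equals `(2l+1) ∫ P_l²`. -/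
lemma integral_legendre_sq (l : ℕ) :
    ∫ t in (-1 : ℝ)..1, (legendre l * legendre l).eval t = 2 / (2 * l + 1) := by
  have hrec : ∃ q : ℝ[X], q.degree < l ∧
      derivative (legendre (l + 1)) = C (2 * (l : ℝ) + 1) * legendre l + q := by
    rcases l with _ | l
    · refine ⟨0, by simp, ?_⟩
      simp [legendre_zero, legendre_one]
    · refine ⟨derivative (legendre l), (degree_derivative_legendre_lt l).trans_le ?_, ?_⟩
      · exact_mod_cast Nat.le_succ l
      · rw [derivative_legendre_add_two]
        push_cast
        ring_nf
  obtain ⟨q, hq, hd⟩ := hrec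
  have h1 := integral_eval_derivative_mul (legendre (l + 1)) (legendre l) (-1) 1
  rw [integral_legendre_mul_eq_zero (l := l + 1) ((degree_derivative_legendre_lt l).trans_le
    (by exact_mod_cast Nat.le_succ l)), hd] at h1
  have h2 : ∀ t : ℝ, ((C (2 * (l : ℝ) + 1) * legendre l + q) * legendre l).eval t =
      (2 * (l : ℝ) + 1) * (legendre l * legendre l).eval t + (legendre l * q).eval t := by
    intro t
    simp only [eval_mul, eval_add, eval_C]
    ring
  simp only [h2] at h1
  rw [intervalIntegral.integral_add ((intervalIntegrable_eval _ _ _).const_mul _)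
    (intervalIntegrable_eval _ _ _), intervalIntegral.integral_const_mul,
    integral_legendre_mul_eq_zero hq] at h1
  simp only [eval_mul, legendre_eval_of_sq_eq_one _ (show (1 : ℝ) ^ 2 = 1 by norm_num),
    legendre_eval_of_sq_eq_one _ (show (-1 : ℝ) ^ 2 = 1 by norm_num)] at h1
  rw [eq_div_iff (by positivity), mul_comm]
  have h3 : (-1 : ℝ) ^ (l + 1) * (-1) ^ l = -1 := by
    rw [pow_succ, mul_right_comm, ← mul_pow]
    simp
  rw [h3] at h1
  norm_num at h1
  simpa only [eval_mul] using h1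

lemma eq_zero_of_integral_sq_eq_zero {p : ℝ[X]}
    (h : ∫ t in (-1 : ℝ)..1, (p * p).eval t = 0) : p = 0 := by
  by_contra hp
  have hpos : 0 < ∫ t in (-1 : ℝ)..1, (p * p).eval t := by
    obtain ⟨c, hc, hcp⟩ : ∃ c ∈ Set.Icc (-1 : ℝ) 1, p.eval c ≠ 0 := by
      by_contra! hall
      exact hp (eq_zero_of_infinite_isRoot p
        ((Set.Icc_infinite (by norm_num : (-1 : ℝ) < 1)).mono hall))
    refine intervalIntegral.integral_pos (by norm_num) (p * p).continuous.continuousOn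
      (fun t _ => ?_) ⟨c, hc, ?_⟩
    · rw [eval_mul]; exact mul_self_nonneg _
    · rw [eval_mul]; exact mul_self_pos.2 hcp
  exact hpos.ne' h

/-- A polynomial of degree at most `l` orthogonal to all polynomials of degree less than `l` is a
multiple of `P_l`. -/
lemma eq_C_mul_legendre {l : ℕ} {g : ℝ[X]} (hg : g.natDegree ≤ l)
    (h : ∀ q : ℝ[X], q.degree < l → ∫ t in (-1 : ℝ)..1, (g * q).eval t = 0) :
    ∃ c : ℝ, g = C c * legendre l := by
  -- Otherwise `P_l` would have degree below `l` and be orthogonal to itself.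
  have hlead : (legendre l).coeff l ≠ 0 := by
    intro h0
    have hlt : (legendre l).degree < l :=
      (degree_lt_iff_coeff_zero _ _).2 fun m hm => by
        rcases hm.eq_or_lt with rfl | hm
        · exact h0
        · exact coeff_eq_zero_of_natDegree_lt ((natDegree_legendre_le l).trans_lt hm)
    have h1 := integral_legendre_mul_eq_zero hlt
    rw [integral_legendre_sq] at h1
    have : (0 : ℝ) < 2 / (2 * l + 1) := by positivity
    exact this.ne' h1
  set c := g.coeff l / (legendre l).coeff l
  have hr : (g - C c * legendre l).degree < l :=
    (degree_lt_iff_coeff_zero _ _).2 fun m hm => by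
      rcases hm.eq_or_lt with rfl | hm
      · simp [c, hlead]
      · rw [coeff_sub, coeff_C_mul, coeff_eq_zero_of_natDegree_lt (hg.trans_lt hm),
          coeff_eq_zero_of_natDegree_lt ((natDegree_legendre_le l).trans_lt hm)]
        simp
  refine ⟨c, sub_eq_zero.1 (eq_zero_of_integral_sq_eq_zero ?_)⟩
  have e : ∀ t : ℝ, ((g - C c * legendre l) * (g - C c * legendre l)).eval t =
      (g * (g - C c * legendre l)).eval t - c * (legendre l * (g - C c * legendre l)).eval t := by
    intro t
    simp only [eval_mul, eval_sub, eval_C]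
    ring
  simp only [e]
  rw [intervalIntegral.integral_sub (intervalIntegrable_eval _ _ _)
    ((intervalIntegrable_eval _ _ _).const_mul _), intervalIntegral.integral_const_mul, h _ hr,
    integral_legendre_mul_eq_zero hr]
  simp

end LegendrePolynomials

/-! ### Isometries of the sphere -/

/-- The cosine of the geodesic distance. -/
def cosDist (x y : S2) : ℝ :=
  inner ℝ (x : EuclideanSpace ℝ (Fin 3)) (y : EuclideanSpace ℝ (Fin 3))

lemma cosDist_comm (x y : S2) : cosDist x y = cosDist y x := real_inner_comm _ _

lemma norm_coe_S2 (x : S2) : ‖(x : EuclideanSpace ℝ (Fin 3))‖ = 1 := by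
  simp

lemma cosDist_self (x : S2) : cosDist x x = 1 := by
  rw [cosDist, real_inner_self_eq_norm_sq, norm_coe_S2, one_pow]

lemma abs_cosDist_le_one (x y : S2) : |cosDist x y| ≤ 1 := by
  simpa [norm_coe_S2, cosDist] using abs_real_inner_le_norm (x : EuclideanSpace ℝ (Fin 3)) y

lemma cosDist_mem_Icc (x y : S2) : cosDist x y ∈ Set.Icc (-1 : ℝ) 1 :=
  abs_le.1 (abs_cosDist_le_one x y)

lemma cos_geoDist (x y : S2) : Real.cos (geoDist x y) = cosDist x y := by
  rw [geoDist, InnerProductGeometry.cos_angle, norm_coe_S2, norm_coe_S2, cosDist]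
  simp

@[fun_prop]
lemma continuous_cosDist : Continuous fun p : S2 × S2 => cosDist p.1 p.2 := by
  unfold cosDist
  fun_prop

@[fun_prop]
lemma continuous_cosDist_right (x : S2) : Continuous fun y : S2 => cosDist x y := by
  unfold cosDist
  fun_prop

lemma dist_sq_eq (x y : S2) : dist x y ^ 2 = 2 - 2 * cosDist x y := by
  rw [Subtype.dist_eq, dist_eq_norm, norm_sub_sq_real, norm_coe_S2, norm_coe_S2, cosDist]
  ring

lemma cosDist_isometry (ζ : S2 ≃ᵢ S2) (x y : S2) : cosDist (ζ x) (ζ y) = cosDist x y := by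
  have h1 := dist_sq_eq (ζ x) (ζ y)
  rw [ζ.isometry.dist_eq, dist_sq_eq] at h1
  linarith

/-- The isometry of the sphere induced by a linear isometry of the ambient space. -/
def sphereIsometry (A : EuclideanSpace ℝ (Fin 3) ≃ₗᵢ[ℝ] EuclideanSpace ℝ (Fin 3)) : S2 ≃ᵢ S2 where
  toFun x := ⟨A x, by simp⟩
  invFun x := ⟨A.symm x, by simp⟩
  left_inv x := by simp
  right_inv x := by simp
  isometry_toFun x y := by simp [Subtype.edist_eq]

@[simp]
lemma coe_sphereIsometry (A : EuclideanSpace ℝ (Fin 3) ≃ₗᵢ[ℝ] EuclideanSpace ℝ (Fin 3)) (x : S2) :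
    (sphereIsometry A x : EuclideanSpace ℝ (Fin 3)) = A x := rfl

open scoped Pointwise in
-- The area of `s` is a multiple of the volume of the cone `(0, 1) • s`; a linear isometry maps
-- cones to cones and preserves volume.
lemma measurePreserving_sphereIsometry
    (A : EuclideanSpace ℝ (Fin 3) ≃ₗᵢ[ℝ] EuclideanSpace ℝ (Fin 3)) :
    MeasurePreserving (sphereIsometry A) area area := by
  have hm : Measurable (sphereIsometry A) := (sphereIsometry A).continuous.measurable
  refine ⟨hm, ?_⟩
  ext s hs
  rw [Measure.map_apply hm hs, Measure.toSphere_apply' _ (hm hs), Measure.toSphere_apply' _ hs]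
  congr 1
  rw [← A.measurePreserving.measure_preimage_equiv (f := A.toHomeomorph.toMeasurableEquiv)
    (Set.Ioo (0 : ℝ) 1 • (Subtype.val '' s : Set (EuclideanSpace ℝ (Fin 3))))]
  congr 1
  ext v
  simp only [Set.mem_smul, Set.mem_preimage, Set.mem_image]
  constructor
  · rintro ⟨r, hr, w, ⟨x, hx, rfl⟩, rfl⟩
    exact ⟨r, hr, _, ⟨_, hx, rfl⟩, by simp⟩
  · rintro ⟨r, hr, w, ⟨x, hx, rfl⟩, h⟩
    refine ⟨r, hr, _, ⟨(sphereIsometry A).symm x, by simpa using hx, rfl⟩, ?_⟩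
    apply A.injective
    rw [map_smul]
    refine Eq.trans ?_ h
    congr 1
    exact A.apply_symm_apply _

/-- The point of the sphere at a unit vector of the standard basis. -/
def axisPoint (i : Fin 3) : S2 := ⟨EuclideanSpace.single i 1, by simp⟩

lemma cosDist_axisPoint (i j : Fin 3) :
    cosDist (axisPoint i) (axisPoint j) = if i = j then 1 else 0 := by
  simp [cosDist, axisPoint, EuclideanSpace.inner_single_left]

lemma exists_orthonormalBasis_of_cosDist {v : Fin 3 → S2}
    (h : ∀ i j, cosDist (v i) (v j) = if i = j then 1 else 0) :
    ∃ b : OrthonormalBasis (Fin 3) ℝ (EuclideanSpace ℝ (Fin 3)), ∀ i, b i = v i := by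
  have ho : Orthonormal ℝ ((Set.univ : Set (Fin 3)).domRestrict
      fun i => (v i : EuclideanSpace ℝ (Fin 3))) :=
    (orthonormal_iff_ite.2 h).comp _ Subtype.val_injective
  obtain ⟨b, hb⟩ := ho.exists_orthonormalBasis_extension_of_card_eq (by simp)
  exact ⟨b, fun i => hb i trivial⟩

/-- Every isometry of the sphere is the restriction of a linear isometry. -/
lemma exists_eq_sphereIsometry (ζ : S2 ≃ᵢ S2) :
    ∃ A : EuclideanSpace ℝ (Fin 3) ≃ₗᵢ[ℝ] EuclideanSpace ℝ (Fin 3), ζ = sphereIsometry A := by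
  -- The images of the axis points form an orthonormal basis, in which `ζ x` has the same
  -- coordinates as `x` in the standard one.
  obtain ⟨b, hb⟩ := exists_orthonormalBasis_of_cosDist (v := fun i => ζ (axisPoint i))
    fun i j => by rw [cosDist_isometry, cosDist_axisPoint]
  refine ⟨b.repr.symm, ?_⟩
  ext1 x
  apply Subtype.ext
  rw [coe_sphereIsometry]
  apply b.repr.injective
  rw [LinearIsometryEquiv.apply_symm_apply]
  ext i
  rw [b.repr_apply_apply, hb]
  change cosDist (ζ (axisPoint i)) (ζ x) = _
  rw [cosDist_isometry]
  simp [cosDist, axisPoint, EuclideanSpace.inner_single_left]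

lemma measurePreserving_isometry (ζ : S2 ≃ᵢ S2) : MeasurePreserving ζ area area := by
  obtain ⟨A, rfl⟩ := exists_eq_sphereIsometry ζ
  exact measurePreserving_sphereIsometry A

lemma integral_comp_isometry {F : Type*} [NormedAddCommGroup F] [NormedSpace ℝ F]
    (ζ : S2 ≃ᵢ S2) (f : S2 → F) : ∫ z, f (ζ z) ∂area = ∫ z, f z ∂area :=
  (measurePreserving_isometry ζ).integral_comp ζ.toHomeomorph.measurableEmbedding f

lemma exists_isometry_axisPoint {y e : S2} (h : cosDist y e = 0) :
    ∃ ζ : S2 ≃ᵢ S2, ζ (axisPoint 0) = y ∧ ζ (axisPoint 1) = e := by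
  have ho : Orthonormal ℝ (({0, 1} : Set (Fin 3)).domRestrict
      ![(y : EuclideanSpace ℝ (Fin 3)), e, 0]) := by
    rw [orthonormal_iff_ite]
    have h' : cosDist e y = 0 := by rw [cosDist_comm, h]
    unfold cosDist at h h'
    rintro ⟨i, hi⟩ ⟨j, hj⟩
    simp only [Set.mem_insert_iff, Set.mem_singleton_iff] at hi hj
    rcases hi with rfl | rfl <;> rcases hj with rfl | rfl <;> simp [Set.domRestrict, h, h']
  obtain ⟨b, hb⟩ := ho.exists_orthonormalBasis_extension_of_card_eq (by simp)
  refine ⟨sphereIsometry b.repr.symm, ?_, ?_⟩ <;> apply Subtype.ext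
  · simpa [axisPoint] using hb 0 (by simp)
  · simpa [axisPoint] using hb 1 (by simp)

lemma exists_cosDist_eq_zero (y : S2) : ∃ e, cosDist y e = 0 := by
  have ho : Orthonormal ℝ (({0} : Set (Fin 3)).domRestrict
      ![(y : EuclideanSpace ℝ (Fin 3)), 0, 0]) := by
    rw [orthonormal_iff_ite]
    rintro ⟨i, hi⟩ ⟨j, hj⟩
    simp only [Set.mem_singleton_iff] at hi hj
    subst hi hj
    simp [Set.domRestrict]
  obtain ⟨b, hb⟩ := ho.exists_orthonormalBasis_extension_of_card_eq (by simp)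
  have h0 : b 0 = y := by simpa using hb 0 (by simp)
  refine ⟨⟨b 1, by simp⟩, ?_⟩
  rw [cosDist, ← h0]
  exact b.orthonormal.2 (by decide)

/-- Isometries act transitively on orthogonal pairs of points and preserve area. -/
lemma integral_comp_cosDist_pair {F : Type*} [NormedAddCommGroup F] [NormedSpace ℝ F]
    {y e : S2} (h : cosDist y e = 0) (f : ℝ → ℝ → F) :
    ∫ z, f (cosDist y z) (cosDist e z) ∂area =
      ∫ z, f (cosDist (axisPoint 0) z) (cosDist (axisPoint 1) z) ∂area := by
  obtain ⟨ζ, rfl, rfl⟩ := exists_isometry_axisPoint h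
  rw [← integral_comp_isometry ζ]
  simp only [cosDist_isometry]

lemma integral_comp_cosDist {F : Type*} [NormedAddCommGroup F] [NormedSpace ℝ F]
    (y : S2) (f : ℝ → F) :
    ∫ z, f (cosDist y z) ∂area = ∫ z, f (cosDist (axisPoint 0) z) ∂area := by
  obtain ⟨e, he⟩ := exists_cosDist_eq_zero y
  exact integral_comp_cosDist_pair he fun s _ => f s

/-- The decomposition of a point of the sphere along `y` and a direction orthogonal to `y`. -/
lemma exists_cosDist_decomposition (x y : S2) :
    ∃ (e : S2) (c : ℝ), cosDist y e = 0 ∧ c ^ 2 = 1 - cosDist x y ^ 2 ∧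
      ∀ z, cosDist x z = cosDist x y * cosDist y z + c * cosDist e z := by
  set w : EuclideanSpace ℝ (Fin 3) := x - cosDist x y • (y : EuclideanSpace ℝ (Fin 3)) with hw
  have hyw : inner ℝ (y : EuclideanSpace ℝ (Fin 3)) w = 0 := by
    rw [hw, inner_sub_right, inner_smul_right, real_inner_self_eq_norm_sq, norm_coe_S2,
      ← cosDist, cosDist_comm]
    ring
  have hx : (x : EuclideanSpace ℝ (Fin 3)) = cosDist x y • (y : EuclideanSpace ℝ (Fin 3)) + w := by
    rw [hw]; abel
  have hn : ‖w‖ ^ 2 = 1 - cosDist x y ^ 2 := by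
    rw [hw, norm_sub_sq_real, norm_smul, norm_coe_S2, norm_coe_S2, inner_smul_right, ← cosDist,
      mul_one, Real.norm_eq_abs, sq_abs]
    ring
  obtain ⟨e, he, hew⟩ : ∃ e : S2, cosDist y e = 0 ∧ w = ‖w‖ • (e : EuclideanSpace ℝ (Fin 3)) := by
    rcases eq_or_ne w 0 with h0 | h0
    · obtain ⟨e, he⟩ := exists_cosDist_eq_zero y
      exact ⟨e, he, by simp [h0]⟩
    · have hpos : ‖w‖ ≠ 0 := norm_ne_zero_iff.2 h0
      refine ⟨⟨‖w‖⁻¹ • w, by simp [norm_smul, hpos]⟩, ?_, ?_⟩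
      · rw [cosDist, inner_smul_right, hyw, mul_zero]
      · rw [smul_smul, mul_inv_cancel₀ hpos, one_smul]
  refine ⟨e, ‖w‖, he, hn, fun z => ?_⟩
  have : cosDist x z = inner ℝ (cosDist x y • (y : EuclideanSpace ℝ (Fin 3)) +
      ‖w‖ • (e : EuclideanSpace ℝ (Fin 3))) (z : EuclideanSpace ℝ (Fin 3)) := by
    rw [← hew, ← hx, cosDist]
  rw [this, inner_add_left, real_inner_smul_left, real_inner_smul_left]
  rfl

lemma _root_.Continuous.integrable_area {F : Type*} [NormedAddCommGroup F] {f : S2 → F}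
    (hf : Continuous f) : Integrable f area :=
  hf.integrable_of_hasCompactSupport (HasCompactSupport.of_compactSpace f)

/-! ### Integrals of polynomials over the sphere -/

section SphereIntegrals

open Polynomial

lemma measureReal_area_univ : area.real Set.univ = 4 * Real.pi := by
  rw [measureReal_def, Measure.toSphere_apply_univ, EuclideanSpace.volume_ball_fin_three]
  rw [ENNReal.toReal_mul, finrank_euclideanSpace_fin, ENNReal.toReal_mul]
  rw [ENNReal.toReal_ofReal (by positivity)]
  simp
  ring

lemma cosDist_neg_left (x z : S2) : cosDist (-x) z = -cosDist x z := by
  simp [cosDist]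

/-- The pairs `(y, e)` and `(y, -e)` give the same integral, while an odd power changes its sign. -/
lemma integral_mul_pow_odd_eq_zero {y e : S2} (h : cosDist y e = 0) (f : ℝ → ℝ) {j : ℕ}
    (hj : Odd j) : ∫ z, f (cosDist y z) * cosDist e z ^ j ∂area = 0 := by
  have h' : cosDist y (-e) = 0 := by rw [cosDist_comm, cosDist_neg_left, cosDist_comm, h, neg_zero]
  have h1 := integral_comp_cosDist_pair h fun s t => f s * t ^ j
  have h2 := integral_comp_cosDist_pair h' fun s t => f s * t ^ j
  simp only [cosDist_neg_left, hj.neg_pow, mul_neg, integral_neg] at h2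
  linarith

lemma integral_pow_odd_eq_zero (y : S2) {k : ℕ} (hk : Odd k) :
    ∫ z, cosDist y z ^ k ∂area = 0 := by
  obtain ⟨e, he⟩ := exists_cosDist_eq_zero y
  rw [cosDist_comm] at he
  simpa using integral_mul_pow_odd_eq_zero he (fun _ => 1) hk

/-- The vector `y + t e` is `√(1 + t²)` times a point of the sphere, and all points give the same
moment. Both sides are polynomials in `t`, ready for comparison of coefficients. -/
lemma integral_linear_pow {y e : S2} (h : cosDist y e = 0) (n : ℕ) (t : ℝ) :
    ∫ z, (t * cosDist e z + cosDist y z) ^ (2 * n) ∂area =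
      (1 + t ^ 2) ^ n * ∫ z, cosDist y z ^ (2 * n) ∂area := by
  have hpos : 0 < 1 + t ^ 2 := by positivity
  set r := Real.sqrt (1 + t ^ 2) with hr
  have hr2 : r ^ 2 = 1 + t ^ 2 := Real.sq_sqrt hpos.le
  have hr0 : r ≠ 0 := (Real.sqrt_pos.2 hpos).ne'
  have hnorm : ‖(y : EuclideanSpace ℝ (Fin 3)) + t • (e : EuclideanSpace ℝ (Fin 3))‖ = r := by
    rw [hr, eq_comm, Real.sqrt_eq_iff_mul_self_eq hpos.le (norm_nonneg _), ← sq, norm_add_sq_real,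
      norm_smul, norm_coe_S2, norm_coe_S2, inner_smul_right, ← cosDist, h, Real.norm_eq_abs]
    simp
  let x : S2 := ⟨r⁻¹ • ((y : EuclideanSpace ℝ (Fin 3)) + t • (e : EuclideanSpace ℝ (Fin 3))), by
    rw [mem_sphere_zero_iff_norm, norm_smul, hnorm, norm_inv, Real.norm_eq_abs,
      abs_of_nonneg (Real.sqrt_nonneg _), inv_mul_cancel₀ hr0]⟩
  have hx : ∀ z, t * cosDist e z + cosDist y z = r * cosDist x z := by
    intro z
    simp only [x, cosDist, real_inner_smul_left, inner_add_left]
    field_simp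
    ring
  simp only [hx, mul_pow, integral_const_mul]
  rw [integral_comp_cosDist x fun s => s ^ (2 * n), integral_comp_cosDist y fun s => s ^ (2 * n),
    pow_mul r, hr2]

/-- Coefficient of `t²` in `integral_linear_pow` with exponent `n + 1`, using `(2n+2).choose 2 =
(n+1)(2n+1)`. -/
lemma integral_pow_mul_sq {y e : S2} (h : cosDist y e = 0) (n : ℕ) :
    (2 * (n : ℝ) + 1) * ∫ z, cosDist y z ^ (2 * n) * cosDist e z ^ 2 ∂area =
      ∫ z, cosDist y z ^ (2 * n + 2) ∂area := by
  set N := 2 * n + 2 with hN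
  set P : ℝ[X] := ∑ m ∈ Finset.range (N + 1),
    C (∫ z, cosDist e z ^ m * cosDist y z ^ (N - m) * (N.choose m : ℝ) ∂area) * X ^ m with hP
  have hPQ : P = C (∫ z, cosDist y z ^ N ∂area) * expand ℝ 2 ((1 + X) ^ (n + 1)) := by
    refine Polynomial.funext fun t => ?_
    have h1 := integral_linear_pow h (n + 1) t
    simp only [show 2 * (n + 1) = N from by omega, add_pow] at h1
    rw [integral_finsetSum _ fun i _ => (by fun_prop : Continuous _).integrable_area] at h1
    rw [hP, eval_finsetSum]
    simp only [eval_mul, eval_C, eval_pow, eval_X, map_pow, map_add, map_one, expand_X, eval_add,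
      eval_one]
    rw [mul_comm (∫ z, cosDist y z ^ N ∂area), add_pow, ← h1]
    refine Finset.sum_congr rfl fun m _ => ?_
    rw [← integral_mul_const]
    congr 1
    ext z
    ring
  have hc := congrArg (fun p => p.coeff 2) hPQ
  simp only [hP, finsetSum_coeff, coeff_C_mul, coeff_X_pow] at hc
  rw [Finset.sum_eq_single 2 (fun b _ hb => by simp [hb.symm]) (fun h => by simp [hN] at h)] at hc
  have hexp : (expand ℝ 2 ((1 + X : ℝ[X]) ^ (n + 1))).coeff 2 = n + 1 := by
    have := coeff_expand_mul (p := 2) (by norm_num) ((1 + X : ℝ[X]) ^ (n + 1)) 1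
    rw [one_mul] at this
    rw [this, coeff_one_add_X_pow]
    simp
  rw [hexp, integral_mul_const, Nat.cast_choose_two, show N - 2 = 2 * n by omega] at hc
  simp only [hN, if_true, mul_one] at hc
  push_cast at hc
  have hn : (n : ℝ) + 1 ≠ 0 := by positivity
  simp only [mul_comm (cosDist y _ ^ (2 * n))]
  apply mul_right_cancel₀ hn
  linear_combination hc

lemma sum_cosDist_axisPoint_sq (z : S2) : ∑ i, cosDist (axisPoint i) z ^ 2 = 1 := by
  have h := norm_coe_S2 z
  have h2 := EuclideanSpace.real_norm_sq_eq (z : EuclideanSpace ℝ (Fin 3))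
  rw [h, one_pow] at h2
  simp [cosDist, axisPoint, EuclideanSpace.inner_single_left, ← h2]

lemma integral_pow_even (y : S2) (n : ℕ) :
    ∫ z, cosDist y z ^ (2 * n) ∂area = 4 * Real.pi / (2 * n + 1) := by
  rw [integral_comp_cosDist y fun s => s ^ (2 * n)]
  induction n with
  | zero =>
    simp only [mul_zero, pow_zero, integral_const, measureReal_area_univ]
    simp
  | succ n ih =>
    have h1 := integral_pow_mul_sq (y := axisPoint 0) (e := axisPoint 1)
      (by simp [cosDist_axisPoint]) n
    have h2 := integral_pow_mul_sq (y := axisPoint 0) (e := axisPoint 2)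
      (by simp [cosDist_axisPoint]) n
    -- The squared coordinates sum to `1`, which expresses the moment of order `2n` through that of
    -- order `2n + 2`.
    have h3 : ∀ z, cosDist (axisPoint 0) z ^ (2 * n) = cosDist (axisPoint 0) z ^ (2 * n + 2) +
        cosDist (axisPoint 0) z ^ (2 * n) * cosDist (axisPoint 1) z ^ 2 +
        cosDist (axisPoint 0) z ^ (2 * n) * cosDist (axisPoint 2) z ^ 2 := by
      intro z
      have := sum_cosDist_axisPoint_sq z
      rw [Fin.sum_univ_three] at this
      rw [pow_add, ← mul_add, ← mul_add, this, mul_one]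
    have h4 : ∫ z, cosDist (axisPoint 0) z ^ (2 * n) ∂area =
        (∫ z, cosDist (axisPoint 0) z ^ (2 * n + 2) ∂area) +
        (∫ z, cosDist (axisPoint 0) z ^ (2 * n) * cosDist (axisPoint 1) z ^ 2 ∂area) +
        ∫ z, cosDist (axisPoint 0) z ^ (2 * n) * cosDist (axisPoint 2) z ^ 2 ∂area := by
      rw [← integral_add (by fun_prop : Continuous _).integrable_area
        (by fun_prop : Continuous _).integrable_area, ← integral_add
        (by fun_prop : Continuous _).integrable_area (by fun_prop : Continuous _).integrable_area]
      exact integral_congr_ae (.of_forall h3)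
    rw [ih] at h4
    rw [show 2 * (n + 1) = 2 * n + 2 by ring]
    have hn : (2 * (n : ℝ) + 1) ≠ 0 := by positivity
    rw [div_eq_iff hn] at h4
    rw [eq_div_iff (by positivity)]
    push_cast
    linear_combination -h4 - h1 - h2

/-- Archimedes' projection theorem for polynomials, checked on monomials. -/
lemma integral_eval_cosDist (y : S2) (p : ℝ[X]) :
    ∫ z, p.eval (cosDist y z) ∂area = 2 * Real.pi * ∫ t in (-1 : ℝ)..1, p.eval t := by
  have hmon : ∀ k : ℕ, ∫ z, cosDist y z ^ k ∂area = 2 * Real.pi * ∫ t in (-1 : ℝ)..1, t ^ k := by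
    intro k
    rw [integral_pow]
    rcases Nat.even_or_odd k with hk | hk
    · rw [hk.add_one.neg_one_pow]
      obtain ⟨n, rfl⟩ := hk
      rw [← two_mul, integral_pow_even]
      push_cast
      ring
    · rw [integral_pow_odd_eq_zero y hk, hk.add_one.neg_one_pow]
      simp
  simp only [eval_eq_sum_range]
  rw [integral_finsetSum _ fun i _ => (by fun_prop : Continuous _).integrable_area,
    intervalIntegral.integral_finsetSum fun i _ => (by fun_prop : Continuous _).intervalIntegrable _ _,
    Finset.mul_sum]
  refine Finset.sum_congr rfl fun i _ => ?_
  rw [integral_const_mul, intervalIntegral.integral_const_mul, hmon]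
  ring

@[fun_prop]
lemma continuous_eval_cosDist (p : ℝ[X]) :
    Continuous fun w : S2 × S2 => p.eval (cosDist w.1 w.2) :=
  p.continuous.comp continuous_cosDist

@[fun_prop]
lemma continuous_eval_cosDist_right (p : ℝ[X]) (x : S2) :
    Continuous fun z : S2 => p.eval (cosDist x z) :=
  p.continuous.comp (continuous_cosDist_right x)

/-- Split `x` into its part along `y` and a multiple `c e` of a unit vector orthogonal to `y`, and
expand the power. Odd powers of `c` integrate to zero; even ones are powers of `1 - (cosDist x y)²`,
so the result is a polynomial in `cosDist x y`. -/
lemma exists_zonal_pow (k : ℕ) (q : ℝ[X]) :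
    ∃ g : ℝ[X], g.natDegree ≤ k ∧ ∀ x y : S2,
      ∫ z, cosDist x z ^ k * q.eval (cosDist y z) ∂area = g.eval (cosDist x y) := by
  let m : ℕ → ℝ := fun j => ∫ z, cosDist (axisPoint 0) z ^ j * q.eval (cosDist (axisPoint 0) z) *
    cosDist (axisPoint 1) z ^ (k - j) ∂area
  refine ⟨∑ j ∈ Finset.range (k + 1), if Even (k - j) then
    C (m j * (k.choose j : ℝ)) * (X ^ j * (1 - X ^ 2) ^ ((k - j) / 2)) else 0, ?_, fun x y => ?_⟩
  · refine natDegree_sum_le_of_forall_le _ _ fun j hj => ?_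
    rw [Finset.mem_range] at hj
    split_ifs with hev
    · refine (natDegree_C_mul_le _ _).trans (natDegree_mul_le.trans ?_)
      have h1 : ((1 - X ^ 2 : ℝ[X]) ^ ((k - j) / 2)).natDegree ≤ ((k - j) / 2) * 2 :=
        natDegree_pow_le_of_le _ (by compute_degree)
      rw [natDegree_X_pow]
      omega
    · simp
  · obtain ⟨e, c, he, hc, hx⟩ := exists_cosDist_decomposition x y
    have hexp : ∀ z, cosDist x z ^ k * q.eval (cosDist y z) =
        ∑ j ∈ Finset.range (k + 1), (cosDist x y ^ j * c ^ (k - j) * k.choose j) *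
          (cosDist y z ^ j * q.eval (cosDist y z) * cosDist e z ^ (k - j)) := by
      intro z
      rw [hx z, add_pow, Finset.sum_mul]
      refine Finset.sum_congr rfl fun j _ => ?_
      rw [mul_pow, mul_pow]
      ring
    simp only [hexp]
    rw [integral_finsetSum _ fun i _ => (by fun_prop : Continuous _).integrable_area,
      eval_finsetSum]
    refine Finset.sum_congr rfl fun j _ => ?_
    rw [integral_const_mul]
    split_ifs with hev
    · rw [integral_comp_cosDist_pair he fun s t => s ^ j * q.eval s * t ^ (k - j)]
      have hcp : c ^ (k - j) = (1 - cosDist x y ^ 2) ^ ((k - j) / 2) := by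
        rw [← hc, ← pow_mul, Nat.two_mul_div_two_of_even hev]
      simp only [eval_mul, eval_C, eval_pow, eval_X, eval_sub, eval_one, hcp, m]
      ring
    · rw [integral_mul_pow_odd_eq_zero he (fun s => s ^ j * q.eval s)
        (Nat.not_even_iff_odd.1 hev)]
      simp

/-- The spherical convolution of two zonal polynomials is a zonal polynomial. -/
lemma exists_zonal_convolution (p q : ℝ[X]) :
    ∃ g : ℝ[X], g.natDegree ≤ p.natDegree ∧ ∀ x y : S2,
      ∫ z, p.eval (cosDist x z) * q.eval (cosDist y z) ∂area = g.eval (cosDist x y) := by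
  choose g hdeg hg using fun k => exists_zonal_pow k q
  refine ⟨∑ k ∈ Finset.range (p.natDegree + 1), C (p.coeff k) * g k, ?_, fun x y => ?_⟩
  · refine natDegree_sum_le_of_forall_le _ _ fun j hj => (natDegree_C_mul_le _ _).trans ?_
    rw [Finset.mem_range] at hj
    exact (hdeg j).trans (by omega)
  · simp only [eval_eq_sum_range (p := p), Finset.sum_mul]
    rw [integral_finsetSum _ fun i _ => (by fun_prop : Continuous _).integrable_area,
      eval_finsetSum]
    refine Finset.sum_congr rfl fun j _ => ?_
    rw [eval_mul, eval_C, ← hg, ← integral_const_mul]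
    simp only [mul_assoc]

end SphereIntegrals

/-! ### Reproducing kernels -/

section ReproducingKernels

open Polynomial

lemma eq_of_eval_cosDist_eq {g h : ℝ[X]}
    (hgh : ∀ x y : S2, g.eval (cosDist x y) = h.eval (cosDist x y)) : g = h := by
  refine sub_eq_zero.1 (eq_zero_of_integral_sq_eq_zero ?_)
  have h1 := integral_eval_cosDist (axisPoint 0) ((g - h) * (g - h))
  simp only [eval_mul, eval_sub, hgh, sub_self, mul_zero, integral_zero] at h1
  have hpi := Real.pi_pos.ne'
  simpa [hpi] using h1.symm

lemma _root_.Continuous.integrable_area_prod {F : Type*} [NormedAddCommGroup F] {f : S2 × S2 → F}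
    (hf : Continuous f) : Integrable f (area.prod area) :=
  hf.integrable_of_hasCompactSupport (HasCompactSupport.of_compactSpace f)

/-- Zonal convolution is associative, in integrated form. -/
lemma integral_zonal_convolution_mul {p q r g h : ℝ[X]}
    (hg : ∀ x y : S2, ∫ z, p.eval (cosDist x z) * q.eval (cosDist y z) ∂area =
      g.eval (cosDist x y))
    (hh : ∀ x y : S2, ∫ z, r.eval (cosDist x z) * q.eval (cosDist y z) ∂area =
      h.eval (cosDist x y)) :
    ∫ t in (-1 : ℝ)..1, (g * r).eval t = ∫ t in (-1 : ℝ)..1, (p * h).eval t := by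
  have h1 := integral_eval_cosDist (axisPoint 0) (g * r)
  have h2 := integral_eval_cosDist (axisPoint 0) (p * h)
  have hpi : 2 * Real.pi ≠ 0 := by positivity
  apply mul_left_cancel₀ hpi
  rw [← h1, ← h2]
  simp only [eval_mul, ← hg, ← hh, ← integral_mul_const, ← integral_const_mul]
  rw [integral_integral_swap]
  · refine integral_congr_ae (.of_forall fun z => integral_congr_ae (.of_forall fun y => ?_))
    simp only [cosDist_comm y z]
    ring
  · refine Continuous.integrable_area_prod ?_
    simp only [Function.uncurry_def]
    fun_prop

lemma exists_legendre_convolution (k l : ℕ) :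
    ∃ g : ℝ[X], g.natDegree ≤ k ∧ g.natDegree ≤ l ∧ ∀ x y : S2,
      ∫ z, (legendre k).eval (cosDist x z) * (legendre l).eval (cosDist y z) ∂area =
        g.eval (cosDist x y) := by
  obtain ⟨g, hg, hgeq⟩ := exists_zonal_convolution (legendre k) (legendre l)
  obtain ⟨h, hh, hheq⟩ := exists_zonal_convolution (legendre l) (legendre k)
  have hgh : g = h := eq_of_eval_cosDist_eq fun x y => by
    rw [← hgeq, cosDist_comm, ← hheq]
    simp only [mul_comm]
  exact ⟨g, hg.trans (natDegree_legendre_le k), hgh ▸ hh.trans (natDegree_legendre_le l), hgeq⟩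

/-- Associativity moves the convolution with `P_l` onto `r` without raising its degree; what remains
is orthogonality of `P_k` to lower degrees. -/
lemma integral_legendre_convolution_mul_eq_zero {k l : ℕ} {g : ℝ[X]}
    (hg : ∀ x y : S2,
      ∫ z, (legendre k).eval (cosDist x z) * (legendre l).eval (cosDist y z) ∂area =
        g.eval (cosDist x y)) {r : ℝ[X]} (hr : r.degree < k) :
    ∫ t in (-1 : ℝ)..1, (g * r).eval t = 0 := by
  obtain ⟨h, hh, hheq⟩ := exists_zonal_convolution r (legendre l)
  rw [integral_zonal_convolution_mul hg hheq]
  refine integral_legendre_mul_eq_zero ?_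
  rcases eq_or_ne r 0 with rfl | h0
  · have : h = 0 := eq_of_eval_cosDist_eq fun x y => by simp [← hheq]
    rwa [this]
  · refine (degree_le_natDegree.trans ?_).trans_lt hr
    rw [degree_eq_natDegree h0]
    exact_mod_cast hh

/-- The zonal Legendre kernels are orthogonal and reproduce themselves under convolution. -/
lemma integral_legendre_mul_legendre (k l : ℕ) (x y : S2) :
    ∫ z, (legendre k).eval (cosDist x z) * (legendre l).eval (cosDist y z) ∂area =
      if k = l then 4 * Real.pi / (2 * k + 1) * (legendre k).eval (cosDist x y) else 0 := by
  obtain ⟨g, hk, hl, hg⟩ := exists_legendre_convolution k l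
  split_ifs with hkl
  · subst hkl
    -- The convolution is thus a multiple of `P_k`; the factor is read off on the diagonal, where
    -- `P_k 1 = 1`.
    obtain ⟨c, rfl⟩ := eq_C_mul_legendre hk fun r hr =>
      integral_legendre_convolution_mul_eq_zero hg hr
    have h1 := hg x x
    simp only [← eval_mul] at h1
    rw [integral_eval_cosDist, integral_legendre_sq, cosDist_self, eval_mul, eval_C,
      legendre_eval_one, mul_one] at h1
    rw [hg, eval_mul, eval_C, ← h1]
    ring
  · have hg' : ∀ x y : S2,
        ∫ z, (legendre l).eval (cosDist x z) * (legendre k).eval (cosDist y z) ∂area =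
          g.eval (cosDist x y) := by
      intro x y
      rw [cosDist_comm, ← hg]
      simp only [mul_comm]
    -- The degree of `g` is at most `min k l`, and `g` is orthogonal to all degrees below `max k l`,
    -- hence to itself.
    have hsq : ∫ t in (-1 : ℝ)..1, (g * g).eval t = 0 := by
      rcases lt_or_gt_of_ne hkl with h | h
      · exact integral_legendre_convolution_mul_eq_zero hg'
          (degree_le_natDegree.trans_lt (by exact_mod_cast hk.trans_lt h))
      · exact integral_legendre_convolution_mul_eq_zero hg
          (degree_le_natDegree.trans_lt (by exact_mod_cast hl.trans_lt h))
    rw [hg, eq_zero_of_integral_sq_eq_zero hsq, eval_zero]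

/-- `P_l (cosDist x y)` is the normalized inner product of the Legendre kernels at `x` and `y`;
expand the integral of the square of their sum and of their difference. -/
lemma abs_legendre_cosDist_le_one (l : ℕ) (x y : S2) :
    |(legendre l).eval (cosDist x y)| ≤ 1 := by
  have hpos : 0 < 4 * Real.pi / (2 * (l : ℝ) + 1) := by positivity
  have hxx := integral_legendre_mul_legendre l l x x
  have hyy := integral_legendre_mul_legendre l l y y
  have hxy := integral_legendre_mul_legendre l l x y
  simp only [if_true, cosDist_self, legendre_eval_one, mul_one] at hxx hyy hxy
  have hi : ∀ u v : S2, Integrable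
      (fun z => (legendre l).eval (cosDist u z) * (legendre l).eval (cosDist v z)) area :=
    fun u v => (by fun_prop : Continuous _).integrable_area
  have key : ∀ s : ℝ, s * s = 1 → 0 ≤ 2 + 2 * s * (legendre l).eval (cosDist x y) := by
    intro s hs
    have h0 : 0 ≤ ∫ z, ((legendre l).eval (cosDist x z) + s * (legendre l).eval (cosDist y z)) ^ 2
        ∂area := integral_nonneg fun z => sq_nonneg _
    have he : ∀ z, ((legendre l).eval (cosDist x z) + s * (legendre l).eval (cosDist y z)) ^ 2 =
        (legendre l).eval (cosDist x z) * (legendre l).eval (cosDist x z) +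
        (legendre l).eval (cosDist y z) * (legendre l).eval (cosDist y z) +
        2 * s * ((legendre l).eval (cosDist x z) * (legendre l).eval (cosDist y z)) := by
      intro z
      linear_combination (legendre l).eval (cosDist y z) ^ 2 * hs
    simp only [he] at h0
    rw [integral_add ((hi x x).fun_add (hi y y)) ((hi x y).const_mul _), integral_add (hi x x) (hi y y),
      integral_const_mul, hxx, hyy, hxy] at h0
    refine nonneg_of_mul_nonneg_right ?_ hpos
    linarith
  rw [abs_le]
  constructor
  · linarith [key 1 (by norm_num)]
  · linarith [key (-1) (by norm_num)]

lemma exists_cosDist_eq {t : ℝ} (ht : t ∈ Set.Icc (-1 : ℝ) 1) : ∃ x y : S2, cosDist x y = t := by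
  have h0 : 0 ≤ 1 - t ^ 2 := by nlinarith [ht.1, ht.2]
  refine ⟨axisPoint 0, ⟨!₂[t, Real.sqrt (1 - t ^ 2), 0], ?_⟩, ?_⟩
  · rw [mem_sphere_zero_iff_norm, EuclideanSpace.norm_eq, Real.sqrt_eq_one, Fin.sum_univ_three]
    simp [Real.sq_sqrt h0]
  · simp [cosDist, axisPoint, EuclideanSpace.inner_single_left]

lemma abs_legendre_le_one (l : ℕ) {t : ℝ} (ht : t ∈ Set.Icc (-1 : ℝ) 1) :
    |(legendre l).eval t| ≤ 1 := by
  obtain ⟨x, y, rfl⟩ := exists_cosDist_eq ht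
  exact abs_legendre_cosDist_le_one l x y

/-- The ladder relation and `|P_{l+1}| ≤ 1` give the induction step `l² + (2l + 3) ≤ (l + 2)²`. -/
lemma abs_derivative_legendre_le {t : ℝ} (ht : t ∈ Set.Icc (-1 : ℝ) 1) (l : ℕ) :
    |(derivative (legendre l)).eval t| ≤ (l : ℝ) ^ 2 := by
  induction l using Nat.twoStepInduction with
  | zero => simp [legendre_zero]
  | one => simp [legendre_one]
  | more l ih _ =>
    rw [derivative_legendre_add_two, eval_add, eval_mul, eval_C]
    refine (abs_add_le _ _).trans ?_
    rw [abs_mul, abs_of_nonneg (by positivity : (0 : ℝ) ≤ 2 * l + 3)]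
    have h := mul_le_mul_of_nonneg_left (abs_legendre_le_one (l + 1) ht)
      (by positivity : (0 : ℝ) ≤ 2 * l + 3)
    push_cast
    nlinarith

lemma one_sub_legendre_le (l : ℕ) {t : ℝ} (ht : t ∈ Set.Icc (-1 : ℝ) 1) :
    1 - (legendre l).eval t ≤ (l : ℝ) ^ 2 * (1 - t) := by
  have h := (convex_Icc (-1 : ℝ) 1).norm_image_sub_le_of_norm_deriv_le
    (f := fun s => (legendre l).eval s) (C := (l : ℝ) ^ 2) (x := t) (y := 1)
    (fun s _ => (legendre l).differentiableAt) (fun s hs => by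
      rw [Polynomial.deriv, Real.norm_eq_abs]
      exact abs_derivative_legendre_le hs l) ht (by norm_num)
  rw [legendre_eval_one, Real.norm_eq_abs, Real.norm_eq_abs, abs_of_nonneg (sub_nonneg.2 ht.2)] at h
  exact (le_abs_self _).trans h

/-- The zonal polynomial `∑_{l < M} c_l (2l+1)/(4π) P_l`. -/
def zonalPoly (c : ℕ → ℝ) (M : ℕ) : ℝ[X] :=
  ∑ l ∈ Finset.range M, C (c l * ((2 * l + 1) / (4 * Real.pi))) * legendre l

lemma zonalPoly_eval (c : ℕ → ℝ) (M : ℕ) (t : ℝ) :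
    (zonalPoly c M).eval t =
      ∑ l ∈ Finset.range M, c l * ((2 * l + 1) / (4 * Real.pi)) * (legendre l).eval t := by
  simp [zonalPoly, eval_finsetSum]

/-- The weight `(2l+1)/(4π)` makes each Legendre kernel idempotent under convolution, so `c` behaves
as a Fourier multiplier. -/
lemma integral_zonalPoly_mul_zonalPoly (c d : ℕ → ℝ) (M : ℕ) (x y : S2) :
    ∫ z, (zonalPoly c M).eval (cosDist x z) * (zonalPoly d M).eval (cosDist y z) ∂area =
      (zonalPoly (fun l => c l * d l) M).eval (cosDist x y) := by
  simp only [zonalPoly_eval, Finset.sum_mul_sum]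
  rw [integral_finsetSum _ fun i _ => (by fun_prop : Continuous _).integrable_area]
  refine Finset.sum_congr rfl fun k hk => ?_
  rw [integral_finsetSum _ fun i _ => (by fun_prop : Continuous _).integrable_area]
  rw [Finset.sum_eq_single k]
  · have h : ∀ z, c k * ((2 * k + 1) / (4 * Real.pi)) * (legendre k).eval (cosDist x z) *
        (d k * ((2 * k + 1) / (4 * Real.pi)) * (legendre k).eval (cosDist y z)) =
        c k * ((2 * k + 1) / (4 * Real.pi)) * (d k * ((2 * k + 1) / (4 * Real.pi))) *
        ((legendre k).eval (cosDist x z) * (legendre k).eval (cosDist y z)) := fun z => by ring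
    simp only [h]
    rw [integral_const_mul, integral_legendre_mul_legendre, if_pos rfl]
    have := Real.pi_pos.ne'
    field_simp
  · intro l _ hl
    have h : ∀ z, c k * ((2 * k + 1) / (4 * Real.pi)) * (legendre k).eval (cosDist x z) *
        (d l * ((2 * l + 1) / (4 * Real.pi)) * (legendre l).eval (cosDist y z)) =
        c k * ((2 * k + 1) / (4 * Real.pi)) * (d l * ((2 * l + 1) / (4 * Real.pi))) *
        ((legendre k).eval (cosDist x z) * (legendre l).eval (cosDist y z)) := fun z => by ring
    simp only [h]
    rw [integral_const_mul, integral_legendre_mul_legendre, if_neg hl.symm, mul_zero]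
  · exact fun h => absurd hk h

lemma integral_sq_zonalPoly_sub (c : ℕ → ℝ) (M : ℕ) (x y : S2) :
    ∫ z, ((zonalPoly c M).eval (cosDist x z) - (zonalPoly c M).eval (cosDist y z)) ^ 2 ∂area =
      ∑ l ∈ Finset.range M,
        c l ^ 2 * ((2 * l + 1) / (2 * Real.pi)) * (1 - (legendre l).eval (cosDist x y)) := by
  have hi : ∀ u v : S2, Integrable
      (fun z => (zonalPoly c M).eval (cosDist u z) * (zonalPoly c M).eval (cosDist v z)) area :=
    fun u v => (by fun_prop : Continuous _).integrable_area
  have he : ∀ z, ((zonalPoly c M).eval (cosDist x z) - (zonalPoly c M).eval (cosDist y z)) ^ 2 =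
      (zonalPoly c M).eval (cosDist x z) * (zonalPoly c M).eval (cosDist x z) +
      (zonalPoly c M).eval (cosDist y z) * (zonalPoly c M).eval (cosDist y z) -
      2 * ((zonalPoly c M).eval (cosDist x z) * (zonalPoly c M).eval (cosDist y z)) :=
    fun z => by ring
  simp only [he]
  rw [integral_sub ((hi x x).fun_add (hi y y)) ((hi x y).const_mul _), integral_add (hi x x) (hi y y),
    integral_const_mul]
  simp only [integral_zonalPoly_mul_zonalPoly]
  simp only [zonalPoly_eval, cosDist_self, legendre_eval_one]
  rw [← Finset.sum_add_distrib, Finset.mul_sum, ← Finset.sum_sub_distrib]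
  refine Finset.sum_congr rfl fun l _ => ?_
  field_simp
  ring

end ReproducingKernels

/-! ### Zonal convolution operators -/

section ZonalOperators

open Polynomial ComplexConjugate

/-- The operator with kernel `p (cos d(x, z))`. -/
def zonalOp (p : ℝ[X]) (h : S2 → ℂ) (x : S2) : ℂ :=
  ∫ z, h z * ((p.eval (cosDist x z) : ℝ) : ℂ) ∂area

lemma _root_.Continuous.memLp_area {f : S2 → ℂ} (hf : Continuous f) : MemLp f 2 area :=
  hf.memLp_of_hasCompactSupport (HasCompactSupport.of_compactSpace f)

lemma _root_.MeasureTheory.Integrable.mul_continuous {X : Type*} [TopologicalSpace X]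
    [CompactSpace X] [MeasurableSpace X] [OpensMeasurableSpace X] {μ : Measure X} {f g : X → ℂ}
    (hf : Integrable f μ) (hg : Continuous g) : Integrable (fun x => f x * g x) μ := by
  obtain ⟨C, hC⟩ := hg.bounded_above_of_compact_support (HasCompactSupport.of_compactSpace g)
  exact hf.mul_bdd (hg.aestronglyMeasurable) (.of_forall hC)

variable {h : S2 → ℂ}

lemma integrable_zonal (hh : Integrable h area) (p : ℝ[X]) (x : S2) :
    Integrable (fun z => h z * ((p.eval (cosDist x z) : ℝ) : ℂ)) area :=
  hh.mul_continuous (by fun_prop)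

lemma continuous_zonalOp (hh : Integrable h area) (p : ℝ[X]) : Continuous (zonalOp p h) := by
  have hcont : Continuous fun w : S2 × S2 => p.eval (cosDist w.1 w.2) := by fun_prop
  obtain ⟨C, hC⟩ := hcont.bounded_above_of_compact_support (HasCompactSupport.of_compactSpace _)
  refine continuous_of_dominated (bound := fun z => ‖h z‖ * C)
    (fun x => (integrable_zonal hh p x).aestronglyMeasurable) (fun x => .of_forall fun z => ?_)
    (hh.norm.mul_const C) (.of_forall fun z => ?_)
  · rw [norm_mul, Complex.norm_real]
    exact mul_le_mul_of_nonneg_left (hC (x, z)) (norm_nonneg _)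
  · simp only [cosDist_comm _ z]
    fun_prop

lemma zonalOp_add (hh : Integrable h area) (p q : ℝ[X]) (x : S2) :
    zonalOp (p + q) h x = zonalOp p h x + zonalOp q h x := by
  rw [zonalOp, zonalOp, zonalOp, ← integral_add (integrable_zonal hh p x) (integrable_zonal hh q x)]
  simp [mul_add]

lemma integral_zonalOp_mul (hh : Integrable h area) (p : ℝ[X]) {v : S2 → ℂ} (hv : Continuous v) :
    ∫ x, zonalOp p h x * conj (v x) ∂area = ∫ z, h z * conj (zonalOp p v z) ∂area := by
  simp only [zonalOp, ← integral_conj, ← integral_mul_const, ← integral_const_mul]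
  rw [integral_integral_swap]
  · refine integral_congr_ae (.of_forall fun z => integral_congr_ae (.of_forall fun x => ?_))
    simp only [map_mul, Complex.conj_ofReal, cosDist_comm x z]
    ring
  · have := (hh.comp_snd area).mul_continuous (μ := area.prod area)
      (g := fun w => ((p.eval (cosDist w.1 w.2) : ℝ) : ℂ) * conj (v w.1))
      (by fun_prop)
    refine this.congr (.of_forall fun w => ?_)
    simp only [Function.uncurry]
    ring

lemma zonalOp_zonalOp (hh : Integrable h area) {p q g : ℝ[X]}
    (hg : ∀ x y : S2, ∫ z, p.eval (cosDist x z) * q.eval (cosDist y z) ∂area =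
      g.eval (cosDist x y)) (x : S2) : zonalOp p (zonalOp q h) x = zonalOp g h x := by
  simp only [zonalOp, ← integral_mul_const]
  rw [integral_integral_swap]
  · refine integral_congr_ae (.of_forall fun w => ?_)
    simp only [← hg]
    rw [← integral_complex_ofReal, ← integral_const_mul]
    refine integral_congr_ae (.of_forall fun z => ?_)
    simp only [cosDist_comm z w]
    push_cast
    ring
  · have := (hh.comp_snd area).mul_continuous (μ := area.prod area)
      (g := fun w => ((q.eval (cosDist w.1 w.2) : ℝ) : ℂ) * ((p.eval (cosDist x w.1) : ℝ) : ℂ))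
      (by fun_prop)
    refine this.congr (.of_forall fun w => ?_)
    simp only [Function.uncurry]
    ring

/-- The real part of `⟨h, p ⋆ h⟩`. -/
def zonalEnergy (h : S2 → ℂ) (p : ℝ[X]) : ℝ := (∫ z, h z * conj (zonalOp p h z) ∂area).re

lemma integrable_mul_conj_zonalOp (hh : Integrable h area) (p : ℝ[X]) :
    Integrable (fun z => h z * conj (zonalOp p h z)) area :=
  hh.mul_continuous (Complex.continuous_conj.comp (continuous_zonalOp hh p))

lemma zonalEnergy_add (hh : Integrable h area) (p q : ℝ[X]) :
    zonalEnergy h (p + q) = zonalEnergy h p + zonalEnergy h q := by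
  rw [zonalEnergy, zonalEnergy, zonalEnergy, ← Complex.add_re,
    ← integral_add (integrable_mul_conj_zonalOp hh p) (integrable_mul_conj_zonalOp hh q)]
  simp only [zonalOp_add hh, map_add, mul_add]

lemma zonalEnergy_zero : zonalEnergy h 0 = 0 := by
  simp [zonalEnergy, zonalOp]

lemma zonalPoly_add (c d : ℕ → ℝ) (M : ℕ) :
    zonalPoly (fun l => c l + d l) M = zonalPoly c M + zonalPoly d M := by
  simp only [zonalPoly, ← Finset.sum_add_distrib, add_mul, C_add]

lemma zonalEnergy_zonalPoly_sum (hh : Integrable h area) {ι : Type*} (s : Finset ι)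
    (c : ι → ℕ → ℝ) (M : ℕ) :
    zonalEnergy h (zonalPoly (fun l => ∑ j ∈ s, c j l) M) =
      ∑ j ∈ s, zonalEnergy h (zonalPoly (c j) M) := by
  classical
  induction s using Finset.induction_on with
  | empty => simp [zonalPoly, zonalEnergy_zero]
  | insert j s hj ih =>
    simp only [Finset.sum_insert hj]
    rw [zonalPoly_add, zonalEnergy_add hh, ih]

/-- The operator is self-adjoint, and its square has the squared coefficients. -/
lemma integral_norm_sq_zonalOp (hh : Integrable h area) (c : ℕ → ℝ) (M : ℕ) :
    ∫ x, ‖zonalOp (zonalPoly c M) h x‖ ^ 2 ∂area =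
      zonalEnergy h (zonalPoly (fun l => c l ^ 2) M) := by
  have h1 := integral_zonalOp_mul hh (zonalPoly c M) (continuous_zonalOp hh (zonalPoly c M))
  simp only [zonalOp_zonalOp hh (integral_zonalPoly_mul_zonalPoly c c M), Complex.mul_conj,
    Complex.normSq_eq_norm_sq] at h1
  rw [integral_complex_ofReal] at h1
  simp only [zonalEnergy, sq (c _), ← h1, Complex.ofReal_re]

lemma zonalEnergy_zonalPoly_nonneg (hh : Integrable h area) {d : ℕ → ℝ} (hd : ∀ l, 0 ≤ d l)
    (M : ℕ) : 0 ≤ zonalEnergy h (zonalPoly d M) := by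
  have h1 := integral_norm_sq_zonalOp hh (fun l => Real.sqrt (d l)) M
  simp only [Real.sq_sqrt (hd _)] at h1
  rw [← h1]
  exact integral_nonneg fun x => by positivity

/-- Bessel's inequality: for the projection `u` of `h`, expand `0 ≤ ‖h - u‖²`, where `‖u‖²` and `Re
⟨h, u⟩` both equal the energy. -/
lemma zonalEnergy_zonalPoly_one_le (hh : MemLp h 2 area) (M : ℕ) :
    zonalEnergy h (zonalPoly (fun _ => 1) M) ≤ ∫ x, ‖h x‖ ^ 2 ∂area := by
  have hi : Integrable h area := hh.integrable (by norm_num)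
  set u := zonalOp (zonalPoly (fun _ => 1) M) h with hu
  have hc : Continuous u := continuous_zonalOp hi _
  have h1 := integral_norm_sq_zonalOp hi (fun _ => 1) M
  simp only [one_pow] at h1
  have h2 : zonalEnergy h (zonalPoly (fun _ => 1) M) = ∫ x, (h x * conj (u x)).re ∂area := by
    rw [zonalEnergy]
    exact (integral_re (integrable_mul_conj_zonalOp hi _)).symm
  have h3 : 0 ≤ ∫ x, ‖h x - u x‖ ^ 2 ∂area := integral_nonneg fun x => by positivity
  have h4 : ∀ x, ‖h x - u x‖ ^ 2 = ‖h x‖ ^ 2 + ‖u x‖ ^ 2 - 2 * (h x * conj (u x)).re := by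
    intro x
    rw [← Complex.normSq_eq_norm_sq, Complex.normSq_sub, Complex.normSq_eq_norm_sq,
      Complex.normSq_eq_norm_sq]
  simp only [h4] at h3
  have hu2 : Integrable (fun x => ‖u x‖ ^ 2) area := (by fun_prop : Continuous _).integrable_area
  have hh2 : Integrable (fun x => ‖h x‖ ^ 2) area := hh.integrable_norm_pow (by norm_num)
  have hre : Integrable (fun x => (h x * conj (u x)).re) area :=
    (integrable_mul_conj_zonalOp hi _).re
  rw [integral_sub (hh2.fun_add hu2) (hre.const_mul 2), integral_add hh2 hu2, integral_const_mul,
    h1, ← h2] at h3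
  linarith

/-- The frame inequality for a finite family of zonal polynomials. -/
lemma sum_integral_norm_sq_zonalOp_le (hh : MemLp h 2 area) {ι : Type*} (s : Finset ι)
    (c : ι → ℕ → ℝ) (M : ℕ) (hc : ∀ l, ∑ j ∈ s, c j l ^ 2 ≤ 1) :
    ∑ j ∈ s, ∫ x, ‖zonalOp (zonalPoly (c j) M) h x‖ ^ 2 ∂area ≤ ∫ x, ‖h x‖ ^ 2 ∂area := by
  have hi : Integrable h area := hh.integrable (by norm_num)
  simp only [integral_norm_sq_zonalOp hi]
  rw [← zonalEnergy_zonalPoly_sum hi s fun j l => c j l ^ 2]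
  refine le_trans ?_ (zonalEnergy_zonalPoly_one_le hh M)
  -- The defect from the constant multiplier `1` is nonnegative, so it carries nonnegative energy.
  have h1 := zonalEnergy_zonalPoly_nonneg hi (d := fun l => 1 - ∑ j ∈ s, c j l ^ 2)
    (fun l => sub_nonneg.2 (hc l)) M
  have h2 := zonalEnergy_add hi (zonalPoly (fun l => ∑ j ∈ s, c j l ^ 2) M)
    (zonalPoly (fun l => 1 - ∑ j ∈ s, c j l ^ 2) M)
  rw [← zonalPoly_add] at h2
  simp only [add_sub_cancel] at h2
  linarith

lemma norm_integral_mul_le (hh : MemLp h 2 area) {k : S2 → ℝ} (hk : Continuous k) :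
    ‖∫ z, h z * ((k z : ℝ) : ℂ) ∂area‖ ≤
      Real.sqrt (∫ z, ‖h z‖ ^ 2 ∂area) * Real.sqrt (∫ z, k z ^ 2 ∂area) := by
  refine (norm_integral_le_integral_norm _).trans ?_
  have hk' : MemLp (fun z => ‖k z‖) (ENNReal.ofReal 2) area :=
    (by fun_prop : Continuous fun z => ‖k z‖).memLp_of_hasCompactSupport
      (HasCompactSupport.of_compactSpace _)
  have hn : MemLp (fun z => ‖h z‖) (ENNReal.ofReal 2) area := by simpa using hh.norm
  have h1 := integral_mul_le_Lp_mul_Lq_of_nonneg (μ := area) Real.HolderConjugate.two_two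
    (.of_forall fun z => norm_nonneg (h z)) (.of_forall fun z => norm_nonneg (k z)) hn hk'
  simp only [norm_mul, Complex.norm_real]
  rw [Real.sqrt_eq_rpow, Real.sqrt_eq_rpow]
  simpa using h1

lemma norm_zonalOp_sub_le (hh : MemLp h 2 area) (c : ℕ → ℝ) (M : ℕ) (x y : S2) :
    ‖zonalOp (zonalPoly c M) h x - zonalOp (zonalPoly c M) h y‖ ≤
      Real.sqrt (∫ z, ‖h z‖ ^ 2 ∂area) * Real.sqrt (∑ l ∈ Finset.range M,
        c l ^ 2 * ((2 * l + 1) / (2 * Real.pi)) * (1 - (legendre l).eval (cosDist x y))) := by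
  have hi : Integrable h area := hh.integrable (by norm_num)
  rw [← integral_sq_zonalPoly_sub, zonalOp, zonalOp,
    ← integral_sub (integrable_zonal hi _ x) (integrable_zonal hi _ y)]
  have h1 := norm_integral_mul_le hh (k := fun z => (zonalPoly c M).eval (cosDist x z) -
    (zonalPoly c M).eval (cosDist y z)) (by fun_prop)
  simpa only [Complex.ofReal_sub, mul_sub] using h1

end ZonalOperators

/-! ### The generating functions -/

section Generators

lemma bump_nonneg (t : ℝ) : 0 ≤ bump t := by
  rw [bump]
  split_ifs
  · exact (Real.exp_pos _).le
  · exact le_rfl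

lemma bump_le_one (t : ℝ) : bump t ≤ 1 := by
  rw [bump]
  split_ifs with h
  · have : 0 ≤ (1 - t ^ 2)⁻¹ := inv_nonneg.2 (by nlinarith [h.1, h.2])
    rw [Real.exp_le_one_iff]
    linarith
  · exact zero_le_one

lemma measurable_bump : Measurable bump :=
  Measurable.ite measurableSet_Ioo (by fun_prop) measurable_const

variable {α : ℝ}

lemma bumpScaled_eq_zero_of_le (hα : 1 < α) {t : ℝ} (ht : t ≤ α⁻¹) : bumpScaled α t = 0 := by
  rw [bumpScaled, bump, if_neg]
  intro h
  have h1 : 0 < 2 * α / (α - 1) := div_pos (by linarith) (by linarith)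
  have h2 := h.1
  have h3 : 2 * α / (α - 1) * (t - α⁻¹) ≤ 0 := mul_nonpos_of_nonneg_of_nonpos h1.le (by linarith)
  linarith

lemma bumpScaled_eq_zero_of_one_le (hα : 1 < α) {t : ℝ} (ht : 1 ≤ t) : bumpScaled α t = 0 := by
  rw [bumpScaled, bump, if_neg]
  intro h
  have h1 : 0 < 2 * α / (α - 1) := div_pos (by linarith) (by linarith)
  have h2 := h.2
  have h3 : 2 * α / (α - 1) * (1 - α⁻¹) ≤ 2 * α / (α - 1) * (t - α⁻¹) := by gcongr
  have h4 : 2 * α / (α - 1) * (1 - α⁻¹) = 2 := by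
    have : α - 1 ≠ 0 := by linarith
    field_simp
  linarith

/-- No sign condition on `u` is needed: the bump vanishes on `u ≤ α⁻¹`, which includes all `u ≤ 0`.
-/
lemma smoothStep_integrand_nonneg (hα : 1 < α) (u : ℝ) : 0 ≤ bumpScaled α u ^ 2 / u := by
  rcases le_or_gt u α⁻¹ with h | h
  · simp [bumpScaled_eq_zero_of_le hα h]
  · have : 0 < u := (inv_pos.2 (by linarith)).trans h
    positivity

lemma smoothStep_integrand_le (hα : 1 < α) (u : ℝ) : bumpScaled α u ^ 2 / u ≤ α := by
  rcases le_or_gt u α⁻¹ with h | h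
  · simp only [bumpScaled_eq_zero_of_le hα h]
    norm_num
    linarith
  · have h0 : 0 < α := by linarith
    have hu : 0 < u := (inv_pos.2 h0).trans h
    rw [div_le_iff₀ hu]
    have h1 : 1 < α * u := by rwa [inv_lt_iff_one_lt_mul₀' h0] at h
    have h2 : bumpScaled α u ^ 2 ≤ 1 := pow_le_one₀ (bump_nonneg _) (bump_le_one _)
    linarith

lemma intervalIntegrable_smoothStep_integrand (hα : 1 < α) (a b : ℝ) :
    IntervalIntegrable (fun u => bumpScaled α u ^ 2 / u) volume a b := by
  rw [intervalIntegrable_iff]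
  refine Measure.integrableOn_of_bounded (M := α) (by simp) ?_ (.of_forall fun u => ?_)
  · have : Measurable (bumpScaled α) := measurable_bump.comp (by fun_prop)
    exact ((this.pow_const 2).div measurable_id).aestronglyMeasurable
  · rw [Real.norm_eq_abs, abs_of_nonneg (smoothStep_integrand_nonneg hα u)]
    exact smoothStep_integrand_le hα u

lemma antitone_smoothStep (hα : 1 < α) : Antitone (smoothStep α) := by
  have hint := intervalIntegrable_smoothStep_integrand hα
  have hN : ∀ s t : ℝ, s ≤ t →
      ∫ u in t..1, bumpScaled α u ^ 2 / u ≤ ∫ u in s..1, bumpScaled α u ^ 2 / u := by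
    intro s t hst
    rw [← intervalIntegral.integral_add_adjacent_intervals (hint s t) (hint t 1)]
    have := intervalIntegral.integral_nonneg (μ := volume) hst
      fun u _ => smoothStep_integrand_nonneg hα u
    linarith
  intro s t hst
  refine div_le_div_of_nonneg_right (hN s t hst) ?_
  exact intervalIntegral.integral_nonneg (inv_le_one_of_one_le₀ hα.le)
    (fun u _ => smoothStep_integrand_nonneg hα u)

lemma smoothStep_eq_zero (hα : 1 < α) {t : ℝ} (ht : 1 ≤ t) : smoothStep α t = 0 := by
  rw [smoothStep, div_eq_zero_iff]
  left
  rw [intervalIntegral.integral_congr (g := fun _ => 0), intervalIntegral.integral_zero]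
  intro u hu
  rw [Set.uIcc_of_ge ht] at hu
  simp [bumpScaled_eq_zero_of_one_le hα hu.1]

lemma smoothStep_nonneg (hα : 1 < α) (t : ℝ) : 0 ≤ smoothStep α t := by
  rw [← smoothStep_eq_zero hα (le_max_right t 1)]
  exact antitone_smoothStep hα (le_max_left t 1)

lemma smoothStep_le_one (hα : 1 < α) (t : ℝ) : smoothStep α t ≤ 1 := by
  refine (antitone_smoothStep hα (min_le_left t α⁻¹)).trans ?_
  have h0 : ∫ u in (min t α⁻¹)..α⁻¹, bumpScaled α u ^ 2 / u = 0 := by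
    rw [intervalIntegral.integral_congr (g := fun _ => 0), intervalIntegral.integral_zero]
    intro u hu
    rw [Set.uIcc_of_le (min_le_right _ _)] at hu
    simp [bumpScaled_eq_zero_of_le hα hu.2]
  have hint := intervalIntegrable_smoothStep_integrand hα
  rw [smoothStep, ← intervalIntegral.integral_add_adjacent_intervals (hint _ α⁻¹) (hint α⁻¹ 1), h0,
    zero_add]
  -- This also covers a zero denominator, so positivity of the normalizing integral is never
  -- required.
  exact div_self_le_one _

lemma generator_sq (hα : 1 < α) (j l : ℕ) :
    generator α ((α ^ j)⁻¹ * l) ^ 2 =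
      smoothStep α ((α ^ (j + 1))⁻¹ * l) - smoothStep α ((α ^ j)⁻¹ * l) := by
  have h0 : 0 < α := by linarith
  rw [generator, Real.sq_sqrt, pow_succ', mul_inv, mul_assoc]
  refine sub_nonneg.2 (antitone_smoothStep hα ?_)
  exact mul_le_of_le_one_left (by positivity) (inv_le_one_of_one_le₀ hα.le)

/-- The wavelet generating functions have square sum at most one. -/
lemma sum_generator_sq_le_one (hα : 1 < α) (J₀ J l : ℕ) :
    ∑ j ∈ Finset.Icc J₀ J, generator α ((α ^ j)⁻¹ * l) ^ 2 ≤ 1 := by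
  simp only [generator_sq hα]
  refine (Finset.sum_le_sum_of_subset_of_nonneg (t := Finset.range (J + 1)) (fun j hj => ?_)
    fun j _ _ => ?_).trans ?_
  · rw [Finset.mem_Icc] at hj
    rw [Finset.mem_range]
    omega
  · rw [← generator_sq hα]
    positivity
  -- The squares telescope to a difference of two values of `smoothStep`, both in `[0, 1]`.
  · rw [Finset.sum_range_sub fun j => smoothStep α ((α ^ j)⁻¹ * l)]
    have h1 := smoothStep_le_one hα ((α ^ (J + 1))⁻¹ * l)
    have h2 := smoothStep_nonneg hα ((α ^ 0)⁻¹ * l)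
    linarith

lemma one_le_inv_pow_mul (hα : 1 < α) {j l : ℕ} (hl : α ^ j ≤ l) : 1 ≤ (α ^ j)⁻¹ * (l : ℝ) := by
  have h0 : 0 < α ^ j := pow_pos (by linarith) j
  rwa [inv_mul_eq_div, one_le_div h0]

lemma generator_eq_zero (hα : 1 < α) {j l : ℕ} (hl : α ^ (j + 1) ≤ l) :
    generator α ((α ^ j)⁻¹ * l) = 0 := by
  have h := generator_sq hα j l
  rw [smoothStep_eq_zero hα (one_le_inv_pow_mul hα hl), smoothStep_eq_zero hα
    (one_le_inv_pow_mul hα ((pow_le_pow_right₀ hα.le (Nat.le_succ j)).trans hl)), sub_zero] at h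
  exact pow_eq_zero_iff (two_ne_zero) |>.1 h

lemma tsum_coeff_mul_zonalHarmonic {c : ℕ → ℝ} {M : ℕ} (hc : ∀ l, M ≤ l → c l = 0) (ω : S2) :
    ∑' l : ℕ, Real.sqrt ((2 * l + 1) / (4 * Real.pi)) * c l * zonalHarmonic l ω =
      (zonalPoly c M).eval ((ω : EuclideanSpace ℝ (Fin 3)) 2) := by
  rw [tsum_eq_sum (s := Finset.range M), zonalPoly_eval]
  · refine Finset.sum_congr rfl fun l _ => ?_
    rw [zonalHarmonic]
    have h : Real.sqrt ((2 * l + 1) / (4 * Real.pi)) * Real.sqrt ((2 * l + 1) / (4 * Real.pi)) =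
        (2 * l + 1) / (4 * Real.pi) := Real.mul_self_sqrt (by positivity)
    linear_combination c l * (legendre l).eval ((ω : EuclideanSpace ℝ (Fin 3)) 2) * h
  · intro l hl
    rw [Finset.mem_range, not_lt] at hl
    rw [hc l hl]
    simp

lemma wavelet_eq (hα : 1 < α) {j M : ℕ} (hM : α ^ (j + 1) ≤ M) (ω : S2) :
    wavelet α j ω = (((zonalPoly (fun l => generator α ((α ^ j)⁻¹ * l)) M).eval
      ((ω : EuclideanSpace ℝ (Fin 3)) 2) : ℝ) : ℂ) := by
  rw [wavelet, ← tsum_coeff_mul_zonalHarmonic]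
  · rfl
  · intro l hl
    exact generator_eq_zero hα (hM.trans (by exact_mod_cast hl))

lemma scalingFunction_eq (hα : 1 < α) {J₀ M : ℕ} (hM : α ^ J₀ ≤ M) (ω : S2) :
    scalingFunction α J₀ ω =
      (((zonalPoly (fun l => Real.sqrt (smoothStep α ((α ^ J₀)⁻¹ * l))) M).eval
        ((ω : EuclideanSpace ℝ (Fin 3)) 2) : ℝ) : ℂ) := by
  rw [scalingFunction, ← tsum_coeff_mul_zonalHarmonic]
  · rfl
  · intro l hl
    rw [smoothStep_eq_zero hα (one_le_inv_pow_mul hα (hM.trans (by exact_mod_cast hl))),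
      Real.sqrt_zero]

end Generators

/-! ### Convolution with axisymmetric signals -/

section Convolution

open Polynomial

lemma euler_apply_two (a b : ℝ) (i : Fin 3) :
    (euler a b 0 : Matrix (Fin 3) (Fin 3) ℝ) i 2 =
      ![Real.cos a * Real.sin b, Real.sin a * Real.sin b, Real.cos b] i := by
  simp only [euler, rotZ, rotY, Submonoid.coe_mul, Matrix.mul_apply, Fin.sum_univ_three]
  fin_cases i <;> simp

/-- The rotation attached to a point carries the north pole to that point. -/
lemma pointRotation_apply_two (x : S2) (i : Fin 3) :
    (pointRotation x : Matrix (Fin 3) (Fin 3) ℝ) i 2 = (x : EuclideanSpace ℝ (Fin 3)) i := by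
  have hn := EuclideanSpace.real_norm_sq_eq (x : EuclideanSpace ℝ (Fin 3))
  rw [norm_coe_S2, Fin.sum_univ_three] at hn
  set z : ℂ := ⟨(x : EuclideanSpace ℝ (Fin 3)) 0, (x : EuclideanSpace ℝ (Fin 3)) 1⟩ with hz
  -- The longitude enters only multiplied by `‖z‖`, so its default value at the poles is harmless.
  have hsin : Real.sin (colatitude x) = ‖z‖ := by
    rw [colatitude, Real.sin_arccos, Complex.norm_def, Complex.normSq_apply]
    congr 1
    simp only [hz]
    linarith
  have hcos : Real.cos (colatitude x) = (x : EuclideanSpace ℝ (Fin 3)) 2 :=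
    Real.cos_arccos (by nlinarith) (by nlinarith)
  rw [pointRotation, euler_apply_two, hsin, hcos, longitude, ← hz]
  fin_cases i
  · exact (mul_comm _ _).trans (Complex.norm_mul_cos_arg z)
  · exact (mul_comm _ _).trans (Complex.norm_mul_sin_arg z)
  · rfl

lemma rotatePoint_inv_pointRotation (x z : S2) :
    (rotatePoint (pointRotation x)⁻¹ z : EuclideanSpace ℝ (Fin 3)) 2 = cosDist x z := by
  have h1 : (rotatePoint (pointRotation x)⁻¹ z : EuclideanSpace ℝ (Fin 3)) 2 =
      ∑ i, (pointRotation x : Matrix (Fin 3) (Fin 3) ℝ) i 2 *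
        (z : EuclideanSpace ℝ (Fin 3)) i := by
    simp only [rotatePoint, Matrix.mulVec, dotProduct]
    rfl
  rw [h1]
  simp only [pointRotation_apply_two, cosDist, PiLp.inner_apply]
  simp [mul_comm]

lemma conv_eq_zonalOp {p : ℝ[X]} {g : S2 → ℂ}
    (hg : ∀ ω : S2, g ω = ((p.eval ((ω : EuclideanSpace ℝ (Fin 3)) 2) : ℝ) : ℂ)) (f : S2 → ℂ) :
    conv f g = zonalOp p f := by
  ext x
  simp only [conv, rotateSignal, hg, rotatePoint_inv_pointRotation, Complex.conj_ofReal, zonalOp]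

/-- The kernel depends only on the distance and the measure is invariant; orientation-reversing
isometries are included. -/
lemma zonalOp_act (p : ℝ[X]) (ζ : S2 ≃ᵢ S2) (h : S2 → ℂ) :
    zonalOp p (act ζ h) = act ζ (zonalOp p h) := by
  ext x
  rw [act, zonalOp, zonalOp, ← integral_comp_isometry ζ]
  refine integral_congr_ae (.of_forall fun z => ?_)
  simp only [act, IsometryEquiv.symm_apply_apply]
  rw [← cosDist_isometry ζ (ζ.symm x) z, IsometryEquiv.apply_symm_apply]

end Convolution

/-! ### Energy of scattering paths -/

section Energy

open Polynomial

variable {α : ℝ} {f : S2 → ℂ}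

lemma eLpNorm_sq_eq_ofReal (hf : MemLp f 2 area) :
    eLpNorm f 2 area ^ 2 = ENNReal.ofReal (∫ x, ‖f x‖ ^ 2 ∂area) := by
  have h0 : 0 ≤ ∫ x, ‖f x‖ ^ 2 ∂area := integral_nonneg fun x => by positivity
  rw [hf.eLpNorm_eq_integral_rpow_norm (by norm_num) (by norm_num), ← ENNReal.ofReal_pow]
  · congr 1
    simp only [ENNReal.toReal_ofNat, Real.rpow_ofNat]
    rw [← Real.rpow_natCast, ← Real.rpow_mul h0]
    norm_num
  · positivity

lemma conv_wavelet_eq (hα : 1 < α) {j M : ℕ} (hM : α ^ (j + 1) ≤ M) (f : S2 → ℂ) :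
    conv f (wavelet α j) = zonalOp (zonalPoly (fun l => generator α ((α ^ j)⁻¹ * l)) M) f :=
  conv_eq_zonalOp (wavelet_eq hα hM) f

lemma propagator_act (hα : 1 < α) (j : ℕ) (ζ : S2 ≃ᵢ S2) (f : S2 → ℂ) :
    propagator α j (act ζ f) = act ζ (propagator α j f) := by
  obtain ⟨M, hM⟩ := exists_nat_ge (α ^ (j + 1))
  ext x
  simp only [propagator, act]
  rw [conv_wavelet_eq hα hM, conv_wavelet_eq hα hM]
  rw [zonalOp_act, act]

lemma pathPropagator_act (hα : 1 < α) (p : List ℕ) (ζ : S2 ≃ᵢ S2) (f : S2 → ℂ) :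
    pathPropagator α p (act ζ f) = act ζ (pathPropagator α p f) := by
  induction p generalizing f with
  | nil => rfl
  | cons j p ih =>
    change pathPropagator α p (propagator α j (act ζ f)) =
      act ζ (pathPropagator α p (propagator α j f))
    rw [propagator_act hα, ih]

lemma memLp_propagator (hα : 1 < α) (hf : MemLp f 2 area) (j : ℕ) :
    MemLp (propagator α j f) 2 area := by
  obtain ⟨M, hM⟩ := exists_nat_ge (α ^ (j + 1))
  have hi : Integrable f area := hf.integrable (by norm_num)
  refine Continuous.memLp_area ?_
  unfold propagator
  rw [conv_wavelet_eq hα hM]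
  exact Complex.continuous_ofReal.comp (continuous_zonalOp hi _).norm

lemma memLp_pathPropagator (hα : 1 < α) (hf : MemLp f 2 area) (p : List ℕ) :
    MemLp (pathPropagator α p f) 2 area := by
  induction p generalizing f with
  | nil => exact hf
  | cons j p ih => exact ih (memLp_propagator hα hf j)

/-- One layer of the scattering network does not increase the energy. -/
lemma sum_eLpNorm_propagator_sq_le (hα : 1 < α) (hf : MemLp f 2 area) (J₀ J : ℕ) :
    ∑ j ∈ Finset.Icc J₀ J, eLpNorm (propagator α j f) 2 area ^ 2 ≤ eLpNorm f 2 area ^ 2 := by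
  -- One truncation degree serving all scales up to `J`.
  obtain ⟨M, hM⟩ := exists_nat_ge (α ^ (J + 1))
  have hj : ∀ j ∈ Finset.Icc J₀ J, eLpNorm (propagator α j f) 2 area ^ 2 = ENNReal.ofReal
      (∫ x, ‖zonalOp (zonalPoly (fun l => generator α ((α ^ j)⁻¹ * l)) M) f x‖ ^ 2 ∂area) := by
    intro j hj
    have hjM : α ^ (j + 1) ≤ M := (pow_le_pow_right₀ hα.le
      (Nat.succ_le_succ (Finset.mem_Icc.1 hj).2)).trans hM
    rw [eLpNorm_sq_eq_ofReal (memLp_propagator hα hf j)]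
    simp only [propagator, conv_wavelet_eq hα hjM, Complex.norm_real, norm_norm]
  rw [Finset.sum_congr rfl hj, ← ENNReal.ofReal_sum_of_nonneg
    fun j _ => integral_nonneg fun x => by positivity, eLpNorm_sq_eq_ofReal hf]
  exact ENNReal.ofReal_le_ofReal (sum_integral_norm_sq_zonalOp_le hf _
    (fun j l => generator α ((α ^ j)⁻¹ * l)) M fun l => sum_generator_sq_le_one hα J₀ J l)

/-- The paths of depth at most `D`, as a finite set. -/
def pathFinset (J₀ J : ℕ) : ℕ → Finset (List ℕ)
  | 0 => {[]}
  | D + 1 => insert [] ((Finset.Icc J₀ J ×ˢ pathFinset J₀ J D).image fun a => a.1 :: a.2)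

lemma coe_pathFinset (J₀ J D : ℕ) : (pathFinset J₀ J D : Set (List ℕ)) = pathSet J₀ J D := by
  induction D with
  | zero =>
    ext p
    rcases p with _ | ⟨j, p⟩ <;> simp [pathFinset, pathSet]
  | succ D ih =>
    ext p
    have hmem : ∀ q, q ∈ pathFinset J₀ J D ↔ q ∈ pathSet J₀ J D := fun q => by
      rw [← ih, Finset.mem_coe]
    rcases p with _ | ⟨j, p⟩
    · simp [pathFinset, pathSet]
    · simp only [pathFinset, Finset.coe_insert, Set.mem_insert_iff, Finset.coe_image,
        Set.mem_image, Finset.mem_coe, Finset.mem_product, hmem, Finset.mem_Icc, pathSet,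
        Set.mem_ofPred_eq, List.length_cons, List.mem_cons, Prod.exists, List.cons.injEq]
      constructor
      · rintro (h | ⟨a, b, ⟨h1, h2, h3⟩, rfl, rfl⟩)
        · simp at h
        · exact ⟨by omega, by rintro i (rfl | hi); exacts [h1, h3 i hi]⟩
      · rintro ⟨h1, h2⟩
        exact Or.inr ⟨j, p, ⟨h2 j (Or.inl rfl), by omega, fun i hi => h2 i (Or.inr hi)⟩, rfl, rfl⟩

/-- The total energy of all paths of depth at most `D`. -/
lemma sum_eLpNorm_pathPropagator_sq_le (hα : 1 < α) (J₀ J D : ℕ) (hf : MemLp f 2 area) :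
    ∑ p ∈ pathFinset J₀ J D, eLpNorm (pathPropagator α p f) 2 area ^ 2 ≤
      (D + 1) * eLpNorm f 2 area ^ 2 := by
  induction D generalizing f with
  | zero => simp [pathFinset, pathPropagator]
  | succ D ih =>
    -- Split off the empty path and sort the others by first scale: the rest of the path acts on
    -- `U[j] f` with depth at most `D`.
    rw [pathFinset, Finset.sum_insert (by simp), Finset.sum_image (by
      rintro ⟨a, b⟩ _ ⟨c, d⟩ _ h
      simpa using h), Finset.sum_product]
    calc eLpNorm f 2 area ^ 2 + ∑ j ∈ Finset.Icc J₀ J, ∑ p ∈ pathFinset J₀ J D,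
          eLpNorm (pathPropagator α p (propagator α j f)) 2 area ^ 2
        ≤ eLpNorm f 2 area ^ 2 + ∑ j ∈ Finset.Icc J₀ J,
          (D + 1) * eLpNorm (propagator α j f) 2 area ^ 2 := by
          gcongr with j _
          exact ih (memLp_propagator hα hf j)
      _ ≤ eLpNorm f 2 area ^ 2 + (D + 1) * eLpNorm f 2 area ^ 2 := by
          rw [← Finset.mul_sum]
          gcongr
          exact sum_eLpNorm_propagator_sq_le hα hf J₀ J
      _ = ((D + 1 : ℕ) + 1) * eLpNorm f 2 area ^ 2 := by
          push_cast
          ring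

end Energy

/-! ### Displacement by an isometry -/

section Displacement

open Polynomial

variable {α : ℝ}

lemma geoDist_nonneg (x y : S2) : 0 ≤ geoDist x y := InnerProductGeometry.angle_nonneg _ _

lemma geoDist_le_displacement (ζ : S2 ≃ᵢ S2) (ω : S2) : geoDist ω (ζ ω) ≤ displacement ζ :=
  le_ciSup (f := fun ω => geoDist ω (ζ ω))
    ⟨Real.pi, by rintro _ ⟨ω, rfl⟩; exact InnerProductGeometry.angle_le_pi _ _⟩ ω

lemma displacement_nonneg (ζ : S2 ≃ᵢ S2) : 0 ≤ displacement ζ :=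
  (geoDist_nonneg (axisPoint 0) _).trans (geoDist_le_displacement ζ _)

lemma one_sub_cosDist_le (ζ : S2 ≃ᵢ S2) (x : S2) :
    1 - cosDist x (ζ.symm x) ≤ displacement ζ ^ 2 / 2 := by
  have h1 := geoDist_le_displacement ζ (ζ.symm x)
  rw [IsometryEquiv.apply_symm_apply] at h1
  have h2 := Real.one_sub_sq_div_two_le_cos (x := geoDist (ζ.symm x) x)
  rw [cos_geoDist, cosDist_comm] at h2
  have h3 := pow_le_pow_left₀ (geoDist_nonneg _ _) h1 2
  linarith

/-- Each term is at most `l³ ‖ζ‖_∞²` with `l < α ^ J₀` and `l < L`. Bound two factors `l` by `α ^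
J₀` and one by `L`; the number of terms supplies the second `L`. -/
lemma sum_smoothStep_mul_one_sub_legendre_le (hα : 1 < α) {J₀ L : ℕ} (ζ : S2 ≃ᵢ S2) (x : S2) :
    ∑ l ∈ Finset.range L, Real.sqrt (smoothStep α ((α ^ J₀)⁻¹ * l)) ^ 2 *
      ((2 * l + 1) / (2 * Real.pi)) * (1 - (legendre l).eval (cosDist x (ζ.symm x))) ≤
      (α ^ J₀ * L * displacement ζ) ^ 2 := by
  have hα0 : 0 < α := by linarith
  have hN : 0 ≤ α ^ J₀ := by positivity
  have hterm : ∀ l ∈ Finset.range L, Real.sqrt (smoothStep α ((α ^ J₀)⁻¹ * l)) ^ 2 *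
      ((2 * l + 1) / (2 * Real.pi)) * (1 - (legendre l).eval (cosDist x (ζ.symm x))) ≤
      (α ^ J₀) ^ 2 * L * displacement ζ ^ 2 := by
    intro l hl
    rw [Real.sq_sqrt (smoothStep_nonneg hα _)]
    rcases le_or_gt (α ^ J₀) l with h | h
    · rw [smoothStep_eq_zero hα (one_le_inv_pow_mul hα h)]
      simp only [zero_mul]
      positivity
    · have hlL : (l : ℝ) ≤ L := by exact_mod_cast (Finset.mem_range.1 hl).le
      have hl0 : (0 : ℝ) ≤ l := Nat.cast_nonneg l
      have hpi : 1 ≤ Real.pi := by linarith [Real.pi_gt_three]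
      have h1 : 1 - (legendre l).eval (cosDist x (ζ.symm x)) ≤
          (l : ℝ) ^ 2 * (displacement ζ ^ 2 / 2) :=
        (one_sub_legendre_le l (cosDist_mem_Icc _ _)).trans
          (mul_le_mul_of_nonneg_left (one_sub_cosDist_le ζ x) (by positivity))
      have h0 : 0 ≤ 1 - (legendre l).eval (cosDist x (ζ.symm x)) :=
        sub_nonneg.2 (abs_le.1 (abs_legendre_cosDist_le_one l _ _)).2
      calc smoothStep α ((α ^ J₀)⁻¹ * l) * ((2 * l + 1) / (2 * Real.pi)) *
            (1 - (legendre l).eval (cosDist x (ζ.symm x)))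
          ≤ 1 * ((2 * l + 1) / 2) * ((l : ℝ) ^ 2 * (displacement ζ ^ 2 / 2)) := by
            gcongr
            · exact smoothStep_le_one hα _
            · linarith
        _ = ((2 * l + 1) * (l : ℝ) ^ 2) / 4 * displacement ζ ^ 2 := by ring
        _ ≤ ((α ^ J₀) ^ 2 * L) * displacement ζ ^ 2 := by
            refine mul_le_mul_of_nonneg_right ?_ (sq_nonneg _)
            -- For `l ≥ 1` one has `2l + 1 ≤ 4l`; at `l = 0` both sides vanish.
            have h2 : (2 * (l : ℝ) + 1) * (l : ℝ) ^ 2 / 4 ≤ (l : ℝ) ^ 2 * l := by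
              rcases Nat.eq_zero_or_pos l with rfl | hl1
              · simp
              · have : (1 : ℝ) ≤ l := by exact_mod_cast hl1
                nlinarith [sq_nonneg (l : ℝ)]
            refine h2.trans ?_
            gcongr
  refine (Finset.sum_le_card_nsmul _ _ _ hterm).trans (le_of_eq ?_)
  rw [Finset.card_range, nsmul_eq_mul]
  ring

lemma norm_conv_scalingFunction_sub_le (hα : 1 < α) {J₀ L : ℕ} (hL : α ^ J₀ ≤ L) (ζ : S2 ≃ᵢ S2)
    {g : S2 → ℂ} (hg : MemLp g 2 area) (x : S2) :
    ‖conv g (scalingFunction α J₀) x - conv (act ζ g) (scalingFunction α J₀) x‖ ≤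
      α ^ J₀ * L * displacement ζ * Real.sqrt (∫ z, ‖g z‖ ^ 2 ∂area) := by
  have hα0 : 0 < α := by linarith
  rw [conv_eq_zonalOp (scalingFunction_eq hα hL), conv_eq_zonalOp (scalingFunction_eq hα hL),
    zonalOp_act, act, mul_comm]
  refine (norm_zonalOp_sub_le hg _ L x (ζ.symm x)).trans ?_
  gcongr
  refine Real.sqrt_le_iff.2 ⟨?_, sum_smoothStep_mul_one_sub_legendre_le hα ζ x⟩
  have := displacement_nonneg ζ
  positivity

/-- Integrating the uniform bound over the sphere costs `√(4π)`; the constant `4` comes from `4π ≤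
16`. -/
lemma eLpNorm_conv_scalingFunction_sub_sq_le (hα : 1 < α) {J₀ L : ℕ} (hL : α ^ J₀ ≤ L)
    (ζ : S2 ≃ᵢ S2) {g : S2 → ℂ} (hg : MemLp g 2 area) :
    eLpNorm (conv g (scalingFunction α J₀) - conv (act ζ g) (scalingFunction α J₀)) 2 area ^ 2 ≤
      ENNReal.ofReal ((4 * (α ^ J₀ * L * displacement ζ)) ^ 2) * eLpNorm g 2 area ^ 2 := by
  set K := α ^ J₀ * L * displacement ζ with hK
  have hα0 : 0 < α := by linarith
  have hK0 : 0 ≤ K := by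
    have := displacement_nonneg ζ
    positivity
  have h0 : 0 ≤ ∫ z, ‖g z‖ ^ 2 ∂area := integral_nonneg fun x => by positivity
  have h1 := eLpNorm_le_of_ae_bound (p := 2) (μ := area)
    (f := conv g (scalingFunction α J₀) - conv (act ζ g) (scalingFunction α J₀))
    (.of_forall fun x => norm_conv_scalingFunction_sub_le hα hL ζ hg x)
  refine (pow_le_pow_left₀ zero_le h1 2).trans ?_
  rw [mul_pow, ← hK, ← ENNReal.rpow_natCast, ← ENNReal.rpow_mul, eLpNorm_sq_eq_ofReal hg,
    ← ENNReal.ofReal_pow (by positivity), mul_pow K, Real.sq_sqrt h0, mul_pow 4 K,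
    ENNReal.ofReal_mul (by positivity), ENNReal.ofReal_mul (by positivity), mul_assoc]
  gcongr
  have harea : area Set.univ = ENNReal.ofReal (4 * Real.pi) := by
    rw [← measureReal_area_univ, measureReal_def, ENNReal.ofReal_toReal (measure_ne_top _ _)]
  rw [harea]
  simp only [ENNReal.toReal_ofNat, Nat.cast_ofNat]
  rw [inv_mul_cancel₀ two_ne_zero, ENNReal.rpow_one]
  apply ENNReal.ofReal_le_ofReal
  linarith [Real.pi_le_four]

lemma pow_lt_of_lt_maxScale (hα : 1 < α) {J₀ L : ℕ} (h : J₀ < maxScale α L) :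
    1 ≤ L ∧ α ^ J₀ < (L : ℝ) := by
  have hL : 1 ≤ L := by
    rcases Nat.eq_zero_or_pos L with rfl | h0
    -- `Real.logb α 0 = 0` makes the maximum scale `0`, which leaves no room for `J₀`.
    · simp [maxScale] at h
    · exact h0
  refine ⟨hL, ?_⟩
  have h1 : (J₀ : ℝ) < Real.logb α L := Nat.lt_ceil.1 h
  rw [Real.lt_logb_iff_rpow_lt hα (by exact_mod_cast hL), Real.rpow_natCast] at h1
  exact h1

lemma collectionNorm_network_sub_le (hα : 1 < α) {L J₀ : ℕ} (D : ℕ)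
    (hJ : J₀ < maxScale α L) (ζ : S2 ≃ᵢ S2) {f : S2 → ℂ} (hf : MemLp f 2 area) :
    collectionNorm (network α J₀ (pathSet J₀ (maxScale α L) D) f -
        network α J₀ (pathSet J₀ (maxScale α L) D) (act ζ f)) ≤
      ENNReal.ofReal (4 * (L : ℝ) ^ (5 / 2 : ℝ) * ((D : ℝ) + 1) ^ (1 / 2 : ℝ) * α ^ J₀ *
        displacement ζ) * eLpNorm f 2 area := by
  obtain ⟨hL1, hL⟩ := pow_lt_of_lt_maxScale hα hJ
  have hα0 : 0 < α := by linarith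
  have hδ := displacement_nonneg ζ
  have hsum : ∑' p : pathSet J₀ (maxScale α L) D,
      eLpNorm ((network α J₀ (pathSet J₀ (maxScale α L) D) f -
        network α J₀ (pathSet J₀ (maxScale α L) D) (act ζ f)) p) 2 area ^ 2 ≤
      (ENNReal.ofReal (4 * (L : ℝ) ^ (5 / 2 : ℝ) * ((D : ℝ) + 1) ^ (1 / 2 : ℝ) * α ^ J₀ *
        displacement ζ) * eLpNorm f 2 area) ^ 2 := by
    calc _ ≤ ∑' p : pathSet J₀ (maxScale α L) D,
          ENNReal.ofReal ((4 * (α ^ J₀ * L * displacement ζ)) ^ 2) *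
            eLpNorm (pathPropagator α p f) 2 area ^ 2 := by
          refine ENNReal.tsum_le_tsum fun p => ?_
          have := eLpNorm_conv_scalingFunction_sub_sq_le hα hL.le ζ
            (memLp_pathPropagator hα hf (p : List ℕ))
          rwa [← pathPropagator_act hα] at this
      _ = ENNReal.ofReal ((4 * (α ^ J₀ * L * displacement ζ)) ^ 2) *
            ∑ p ∈ pathFinset J₀ (maxScale α L) D, eLpNorm (pathPropagator α p f) 2 area ^ 2 := by
          rw [ENNReal.tsum_mul_left, ← coe_pathFinset]
          congr 1
          exact Finset.tsum_subtype _ fun p => eLpNorm (pathPropagator α p f) 2 area ^ 2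
      _ ≤ ENNReal.ofReal ((4 * (α ^ J₀ * L * displacement ζ)) ^ 2) *
            ((D + 1) * eLpNorm f 2 area ^ 2) := by
          gcongr
          exact sum_eLpNorm_pathPropagator_sq_le hα _ _ D hf
      _ ≤ _ := by
          rw [mul_pow (ENNReal.ofReal _), ← mul_assoc, ← ENNReal.ofReal_pow (by positivity)]
          gcongr
          have hD : ((D : ℝ≥0∞) + 1) = ENNReal.ofReal ((D : ℝ) + 1) := by
            rw [ENNReal.ofReal_add (by positivity) zero_le_one, ENNReal.ofReal_natCast,
              ENNReal.ofReal_one]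
          rw [hD, ← ENNReal.ofReal_mul (by positivity)]
          apply ENNReal.ofReal_le_ofReal
          have e1 : ((L : ℝ) ^ (5 / 2 : ℝ)) ^ 2 = (L : ℝ) ^ 5 := by
            rw [← Real.rpow_natCast, ← Real.rpow_mul (by positivity), ← Real.rpow_natCast]
            norm_num
          have e2 : (((D : ℝ) + 1) ^ (1 / 2 : ℝ)) ^ 2 = (D : ℝ) + 1 := by
            rw [← Real.rpow_natCast, ← Real.rpow_mul (by positivity)]
            norm_num
          -- The argument yields the factor `L`; since `L ≥ 1`, it is weakened to `L ^ (5/2)`.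
          have e3 : (L : ℝ) ^ 2 ≤ (L : ℝ) ^ 5 :=
            pow_le_pow_right₀ (by exact_mod_cast hL1) (by norm_num)
          simp only [mul_pow, e1, e2]
          calc (4 : ℝ) ^ 2 * ((α ^ J₀) ^ 2 * (L : ℝ) ^ 2 * displacement ζ ^ 2) * ((D : ℝ) + 1)
              = 4 ^ 2 * (L : ℝ) ^ 2 * ((D : ℝ) + 1) * (α ^ J₀) ^ 2 * displacement ζ ^ 2 := by ring
            _ ≤ _ := by gcongr
  calc collectionNorm _ ≤ _ := ENNReal.rpow_le_rpow hsum (by norm_num : (0 : ℝ) ≤ 1 / 2)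
    _ = _ := by
      rw [← ENNReal.rpow_natCast, ← ENNReal.rpow_mul]
      norm_num

end Displacement

end SphericalScattering

end

theorem theorem1 :
    ∃ C : ℝ, 0 < C ∧
      ∀ (α : ℝ) (L J₀ D : ℕ), 1 < α → J₀ < SphericalScattering.maxScale α L →
      ∀ (ζ : SphericalScattering.S2 ≃ᵢ SphericalScattering.S2)
        (f : SphericalScattering.S2 → ℂ), MemLp f 2 SphericalScattering.area →
        SphericalScattering.collectionNorm
          (SphericalScattering.network α J₀
              (SphericalScattering.pathSet J₀ (SphericalScattering.maxScale α L) D) f -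
            SphericalScattering.network α J₀
              (SphericalScattering.pathSet J₀ (SphericalScattering.maxScale α L) D)
              (SphericalScattering.act ζ f)) ≤
        ENNReal.ofReal (C * (L : ℝ) ^ (5 / 2 : ℝ) * ((D : ℝ) + 1) ^ (1 / 2 : ℝ) * α ^ J₀ *
            SphericalScattering.displacement ζ) *
          eLpNorm f 2 SphericalScattering.area := by
  exact ⟨4, by norm_num, fun _ _ _ D hα hJ ζ _ hf =>
    SphericalScattering.collectionNorm_network_sub_le hα D hJ ζ hf⟩
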